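/- **Definitions.** A *chain of triangles* consists of $n$ nondegenerate closed triangles $T_1,\dots,T_n$ in the plane, where for each $i<n$ a vertex of $T_i$ and a vertex of $T_{i+1}$ are hinged together (coincide), and for $1<i<n$ the two hinge vertices of $T_i$ are distinct. A *configuration* of a chain is a placement in which no triangle contains an interior point of another; triangles may touch. It is *non-self-touching* if consecutive triangles meet only in their common hinge and all other pairs of triangles are disjoint. A *motion* of a configuration is a continuous family of configurations, over the time interval $[0,1]$ and starting at the given one, in which every triangle moves as a rigid body. The *configuration space* of a configuration is the set of all configurations of the same chain in which every triangle is the image of the original one under an orientation-preserving rigid motion of the plane. A configuration is *rigid* if in every motion, at every time, the whole configuration is the image of the initial one under a single orientation-preserving rigid motion of the plane (so it cannot move at all once a bar, i.e. a side of a triangle, is pinned). A *$\delta$-perturbation* of a configuration is a configuration obtained by repositioning every vertex within distance $\delta$ of its original position (each hinge is a single vertex), without regard to preserving edge lengths. A configuration is *locked within $\varepsilon$* if no motion that leaves some bar pinned to the plane moves any point by more than $\varepsilon$. It is *strongly locked* if for every $\varepsilon>0$ there is a $\delta>0$ such that all its $\delta$-perturbations are locked within $\varepsilon$. It is *locked*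 if some non-self-touching configuration in its configuration space cannot be reached from it by any motion. Let $\ell>0$. In a regular hexagon of side $\ell$ with centre $m$, let $a,p,q,b,r,s$ be the vertices in clockwise order, and let $o=a+p-m$ be the mirror image of $m$ in the side $ap$. The *self-touching chain of seven equilateral triangles* is the chain with, in this order, the triangles $$amp,\quad mbq,\quad brm,\quad rsm,\quad sam,\quad apo,\quad pmq,$$ with consecutive triangles hinged at $m,\,b,\,r,\,s,\,a,\,p$ respectively. **Theorem.** The self-touching chain of seven equilateral triangles is a configuration; it is rigid, and it is strongly locked. For every $\delta>0$ it has non-self-touching $\delta$-perturbations, and there is a $\delta>0$ such that all its non-self-touching $\delta$-perturbations are locked. -/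

import Mathlib

open Complex

noncomputable section

namespace TriangleChain

/-- A placement of `n` labelled triangles in the Euclidean plane, identified with `ℂ`: `c i k` is
the position of vertex `k` of the `i`-th triangle.  In a chain, vertex `1` of a triangle is hinged
to vertex `0` of the next one, so vertices `0` and `1` span the base and `2` is the apex. -/
abbrev Placement (n : ℕ) := Fin n → Fin 3 → ℂ

/-- The `i`-th triangle, as a closed region of the plane. -/
def shape {n : ℕ} (c : Placement n) (i : Fin n) : Set ℂ :=
  convexHull ℝ (Set.range (c i))

/-- A configuration of a chain of triangles: nondegenerate triangles, hinged together one after the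
other, none of which has a point in the interior of another.  Triangles may touch. -/
structure IsConfiguration {n : ℕ} (c : Placement n) : Prop where
  nondegenerate : ∀ i, AffineIndependent ℝ (c i)
  hinged : ∀ i j : Fin n, (j : ℕ) = i + 1 → c i 1 = c j 0
  nonoverlapping : ∀ i j : Fin n, i ≠ j → Disjoint (shape c i) (interior (shape c j))

/-- A configuration without self-touching: consecutive triangles meet only in their common hinge,
all other pairs of triangles are disjoint. -/
structure IsNonSelfTouching {n : ℕ} (c : Placement n) : Prop extends IsConfiguration c where
  consecutive : ∀ i j : Fin n, (j : ℕ) = i + 1 → shape c i ∩ shape c j = {c i 1}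
  nonconsecutive : ∀ i j : Fin n, (i : ℕ) + 1 < j → Disjoint (shape c i) (shape c j)

/-- `q` is obtained from `p` by an orientation-preserving rigid motion of the plane. -/
def RigidlyMoved {ι : Type*} (p q : ι → ℂ) : Prop :=
  ∃ a b : ℂ, ‖a‖ = 1 ∧ ∀ k, q k = a * p k + b

/-- The configuration space of the chain of rigid triangles that has `c` as a placement: all
configurations whose triangles are moved copies (without reflection) of the triangles of `c`. -/
def configSpace {n : ℕ} (c : Placement n) : Set (Placement n) :=
  {c' | IsConfiguration c' ∧ ∀ i, RigidlyMoved (c i) (c' i)}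

/-- A motion of the chain that starts in `c`. -/
structure IsMotion {n : ℕ} (c : Placement n) (γ : unitInterval → Placement n) : Prop where
  continuous : Continuous γ
  start : γ 0 = c
  mem : ∀ t, γ t ∈ configSpace c

/-- A configuration is rigid if it cannot move, except as one rigid body: at every time of every
motion, a single rigid motion of the plane carries all the vertices to their current positions. -/
def Rigid {n : ℕ} (c : Placement n) : Prop :=
  ∀ γ, IsMotion c γ → ∀ t, RigidlyMoved (fun v : Fin n × Fin 3 => c v.1 v.2)
    (fun v : Fin n × Fin 3 => γ t v.1 v.2)

/-- The motion `γ` leaves the bar (side) `jk` of the `i`-th triangle pinned to the plane. -/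
def Pins {n : ℕ} (γ : unitInterval → Placement n) (i : Fin n) (j k : Fin 3) : Prop :=
  ∀ t, γ t i j = γ 0 i j ∧ γ t i k = γ 0 i k

/-- Locked within `ε`: no motion that leaves some bar pinned moves any point by more than `ε`.
Points of a triangle are given by their barycentric coordinates `w`. -/
def LockedWithin {n : ℕ} (ε : ℝ) (c : Placement n) : Prop :=
  ∀ γ, IsMotion c γ → (∃ i j k, j ≠ k ∧ Pins γ i j k) →
    ∀ t i, ∀ w ∈ stdSimplex ℝ (Fin 3), dist (∑ k, w k • γ t i k) (∑ k, w k • c i k) ≤ ε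

/-- `c'` is a `δ`-perturbation of `c`: every vertex (hinges being single vertices) is repositioned
within distance `δ`, edge lengths need not be preserved, and no triangles overlap.  Since the pieces
are solid triangles, non-overlapping is what keeps vertices on the right side of the bars. -/
def IsPerturbation {n : ℕ} (δ : ℝ) (c c' : Placement n) : Prop :=
  IsConfiguration c' ∧ ∀ i k, dist (c' i k) (c i k) ≤ δ

/-- Strongly locked: for every `ε > 0` there is a `δ > 0` such that all `δ`-perturbations are locked
within `ε`. -/
def StronglyLocked {n : ℕ} (c : Placement n) : Prop :=
  ∀ ε : ℝ, 0 < ε → ∃ δ : ℝ, 0 < δ ∧ ∀ c', IsPerturbation δ c c' → LockedWithin ε c'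

/-- Locked: some configuration of the same chain, even one without self-touching, cannot be reached
from `c` by any motion, even if triangles may touch during the motion. -/
def Locked {n : ℕ} (c : Placement n) : Prop :=
  ∃ c' ∈ configSpace c, IsNonSelfTouching c' ∧ ¬ JoinedIn (configSpace c) c c'

/-- The self-touching chain of seven equilateral triangles of side length `ℓ`.  Six of them fill the
regular hexagon with centre `m` and vertices `a, p, q, b, r, s` in clockwise order; the remaining
one, with vertices `a, p, o`, is attached to the hexagon from outside along the side `ap`.
The hinges are, in this order, at `m, b, r, s, a, p`. -/
def tightSeven (ℓ : ℝ) : Placement 7 :=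
  let h : ℝ := √3 / 2
  let m : ℂ := 0
  let a : ℂ := ⟨0, -ℓ⟩
  let p : ℂ := ⟨-h * ℓ, -ℓ / 2⟩
  let q : ℂ := ⟨-h * ℓ, ℓ / 2⟩
  let b : ℂ := ⟨0, ℓ⟩
  let r : ℂ := ⟨h * ℓ, ℓ / 2⟩
  let s : ℂ := ⟨h * ℓ, -ℓ / 2⟩
  let o : ℂ := ⟨-h * ℓ, -3 * ℓ / 2⟩
  ![![a, m, p], ![m, b, q], ![b, r, m], ![r, s, m], ![s, a, m], ![a, p, o], ![p, m, q]]

end TriangleChain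

end

/-! Two nondegenerate triangles do not overlap exactly when a line weakly separates them; in this
form the condition is closed and bounds vertex positions.

The core is `eq_tightSeven_of_near`: with the triangle amp fixed, the tight chain is isolated in its
configuration space. The hinges of apo at a and p are pushed, up to small errors, into the angles
vertically opposite to those of amp, because further triangles lie along the sides am and pm. So
neither can approach the other along ap; since their distance is a bar length, neither moves. The
free vertex of pmq at m stays on a circle about p and in the wedge between amp and mbq; near m these
meet only in m. Finally b is one bar away from m, so b and a are at most two bars apart, while the
hinges r and s between triangles in side contact can only open, so that the bars br, rs, sa span at
least two bar lengths. Equality fixes everything.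

Compactness turns isolation into strong locking: for perturbations c close to the tight chain, no
chain with a triangle fixed is displaced from c by exactly ε, so a pinned motion cannot cross that
displacement. Rigidity follows by regarding the tight chain as its own perturbation for every ε. For
lockedness, small perturbations consist of acute triangles, so laying the bases in a row gives a
configuration without self-touching, too spread out to be reached. -/

noncomputable section

namespace TriangleChain

/-! ### Non-overlapping as weak separation by a line -/

/-- The Euclidean inner product of the plane. -/
def dot (n z : ℂ) : ℝ := n.re * z.re + n.im * z.im

theorem dot_sub (n z w : ℂ) : dot n (z - w) = dot n z - dot n w := by
  simp [dot]; ring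

theorem dot_add (n z w : ℂ) : dot n (z + w) = dot n z + dot n w := by
  simp [dot]; ring

theorem dot_smul (n : ℂ) (t : ℝ) (z : ℂ) : dot n (t • z) = t * dot n z := by
  simp [dot]; ring

theorem dot_self (n : ℂ) : dot n n = ‖n‖ ^ 2 := by
  rw [← Complex.normSq_eq_norm_sq, Complex.normSq_apply, dot]

theorem dot_mul_left (s n z : ℂ) : dot (s * n) (s * z) = ‖s‖ ^ 2 * dot n z := by
  rw [← Complex.normSq_eq_norm_sq, Complex.normSq_apply]; simp [dot]; ring

theorem abs_dot_le (n z : ℂ) : |dot n z| ≤ ‖n‖ * ‖z‖ := by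
  have h := abs_real_inner_le_norm n z
  have e : inner ℝ n z = dot n z := by
    rw [Complex.inner, dot]; simp; ring
  rwa [e] at h

theorem isLinearMap_dot (n : ℂ) : IsLinearMap ℝ (dot n) :=
  ⟨dot_add n, fun t z => dot_smul n t z⟩

/-- Two triples of points are weakly separated by a line. -/
def Separated (p q : Fin 3 → ℂ) : Prop :=
  ∃ n : ℂ, ‖n‖ = 1 ∧ ∀ k l, dot n (p k) ≤ dot n (q l)

theorem separated_of_ne_zero {p q : Fin 3 → ℂ} {n : ℂ} (hn : n ≠ 0)
    (h : ∀ k l, dot n (p k) ≤ dot n (q l)) : Separated p q := by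
  have hn' : 0 < ‖n‖ := norm_pos_iff.2 hn
  refine ⟨(‖n‖⁻¹ : ℝ) • n, ?_, fun k l => ?_⟩
  · rw [norm_smul, norm_inv, norm_norm, inv_mul_cancel₀ hn'.ne']
  · have e : ∀ z, dot ((‖n‖⁻¹ : ℝ) • n) z = ‖n‖⁻¹ * dot n z := fun z => by simp [dot]; ring
    rw [e, e]
    exact mul_le_mul_of_nonneg_left (h k l) (by positivity)

theorem Separated.symm {p q : Fin 3 → ℂ} (h : Separated p q) : Separated q p := by
  obtain ⟨n, hn, h⟩ := h
  refine ⟨-n, by simpa using hn, fun k l => ?_⟩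
  have e : ∀ z, dot (-n) z = - dot n z := fun z => by simp [dot]; ring
  rw [e, e]
  linarith [h l k]

theorem Separated.affine {p q : Fin 3 → ℂ} (h : Separated p q) {s : ℂ} (hs : s ≠ 0) (t : ℂ) :
    Separated (fun k => s * p k + t) (fun k => s * q k + t) := by
  obtain ⟨n, hn, h⟩ := h
  have hn0 : n ≠ 0 := by rintro rfl; simp at hn
  refine separated_of_ne_zero (mul_ne_zero hs hn0) fun k l => ?_
  rw [dot_add, dot_add, dot_mul_left, dot_mul_left]
  have := mul_le_mul_of_nonneg_left (h k l) (sq_nonneg ‖s‖)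
  linarith

theorem dot_le_of_mem_convexHull {p : Fin 3 → ℂ} {n : ℂ} {c : ℝ} (h : ∀ k, dot n (p k) ≤ c)
    {z : ℂ} (hz : z ∈ convexHull ℝ (Set.range p)) : dot n z ≤ c :=
  convexHull_min (s := Set.range p) (t := {z | dot n z ≤ c}) (by rintro _ ⟨k, rfl⟩; exact h k)
    (convex_halfSpace_le (isLinearMap_dot n) c) hz

theorem le_dot_of_mem_convexHull {p : Fin 3 → ℂ} {n : ℂ} {c : ℝ} (h : ∀ k, c ≤ dot n (p k))
    {z : ℂ} (hz : z ∈ convexHull ℝ (Set.range p)) : c ≤ dot n z :=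
  convexHull_min (s := Set.range p) (t := {z | c ≤ dot n z}) (by rintro _ ⟨k, rfl⟩; exact h k)
    (convex_halfSpace_ge (isLinearMap_dot n) c) hz

/-- A common point interior to the second triangle could be pushed a little against the normal
without leaving that triangle, thus crossing the line. -/
theorem Separated.disjoint_interior {p q : Fin 3 → ℂ} (h : Separated p q) :
    Disjoint (convexHull ℝ (Set.range p)) (interior (convexHull ℝ (Set.range q))) := by
  obtain ⟨n, hn, h⟩ := h
  rw [Set.disjoint_left]
  intro x hx hx'
  have h1 : ∀ l, dot n x ≤ dot n (q l) := fun l => dot_le_of_mem_convexHull (fun k => h k l) hx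
  have hc : Filter.Tendsto (fun τ : ℝ => x - τ • n) (nhds 0) (nhds x) := by
    have : Continuous fun τ : ℝ => x - τ • n := by fun_prop
    simpa using this.tendsto 0
  have h2 := hc.eventually (mem_interior_iff_mem_nhds.1 hx')
  obtain ⟨τ, hτ, hτ0⟩ := ((h2.filter_mono nhdsWithin_le_nhds).and
    (self_mem_nhdsWithin (s := Set.Ioi (0 : ℝ)))).exists
  have h3 := le_dot_of_mem_convexHull h1 hτ
  rw [dot_sub, dot_smul, dot_self, hn] at h3
  linarith

/-- Hahn–Banach separates the open interior from the other triangle. Nondegeneracy makes the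
interior dense in the triangle, so the inequality extends to the vertices. -/
theorem separated_of_disjoint_interior {p q : Fin 3 → ℂ} (hq : AffineIndependent ℝ q)
    (h : Disjoint (convexHull ℝ (Set.range p)) (interior (convexHull ℝ (Set.range q)))) :
    Separated p q := by
  have hne : (interior (convexHull ℝ (Set.range q))).Nonempty := by
    rw [interior_convexHull_nonempty_iff_affineSpan_eq_top,
      hq.affineSpan_eq_top_iff_card_eq_finrank_add_one]
    simp
  obtain ⟨f, u, hf, hf'⟩ := geometric_hahn_banach_open (convex_convexHull ℝ (Set.range q)).interior
    isOpen_interior (convex_convexHull ℝ (Set.range p)) h.symm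
  have hle : ∀ l, f (q l) ≤ u := by
    intro l
    have hm : q l ∈ closure (interior (convexHull ℝ (Set.range q))) := by
      rw [(convex_convexHull ℝ _).closure_interior_eq_closure_of_nonempty_interior hne]
      exact subset_closure (subset_convexHull ℝ _ ⟨l, rfl⟩)
    exact closure_minimal (s := interior (convexHull ℝ (Set.range q))) (t := {z | f z ≤ u})
      (fun z hz => (hf z hz).le) (isClosed_le f.continuous continuous_const) hm
  have hge : ∀ k, u ≤ f (p k) := fun k => hf' _ (subset_convexHull ℝ _ ⟨k, rfl⟩)
  have hfe : ∀ z : ℂ, f z = dot ⟨f 1, f I⟩ z := by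
    intro z
    conv_lhs => rw [← Complex.re_add_im z]
    have e : ((z.re : ℂ) + z.im * I) = z.re • (1 : ℂ) + z.im • I := by simp
    rw [e, map_add, map_smul, map_smul, dot]
    simp [mul_comm]
  refine Separated.symm (separated_of_ne_zero (n := ⟨f 1, f I⟩) ?_ fun k l => ?_)
  · intro h0
    obtain ⟨y, hy⟩ := hne
    have h1 := hf y hy
    have h2 := hge 0
    rw [hfe, h0] at h1 h2
    simp [dot] at h1 h2
    linarith
  · rw [← hfe, ← hfe]
    exact (hle k).trans (hge l)

theorem IsConfiguration.separated {n : ℕ} {c : Placement n} (h : IsConfiguration c) {i j : Fin n}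
    (hij : i ≠ j) : Separated (c i) (c j) :=
  separated_of_disjoint_interior (h.nondegenerate j) (h.nonoverlapping i j hij)

theorem isConfiguration_of_separated {n : ℕ} {c : Placement n}
    (h₁ : ∀ i, AffineIndependent ℝ (c i)) (h₂ : ∀ i j : Fin n, (j : ℕ) = i + 1 → c i 1 = c j 0)
    (h₃ : ∀ i j : Fin n, i < j → Separated (c i) (c j)) : IsConfiguration c where
  nondegenerate := h₁
  hinged := h₂
  nonoverlapping i j hij := by
    rcases lt_or_gt_of_ne hij with h | h
    · exact (h₃ i j h).disjoint_interior
    · exact (h₃ j i h).symm.disjoint_interior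

theorem affineIndependent_iff_cross {p : Fin 3 → ℂ} : AffineIndependent ℝ p ↔
    (p 1 - p 0).re * (p 2 - p 0).im - (p 1 - p 0).im * (p 2 - p 0).re ≠ 0 := by
  have e : (fun i : { x : Fin 3 // x ≠ 0 } => p i -ᵥ p 0) ∘ finSuccAboveEquiv (0 : Fin 3) =
      ![p 1 - p 0, p 2 - p 0] := by
    ext i; fin_cases i <;> rfl
  rw [affineIndependent_iff_linearIndependent_vsub ℝ p (0 : Fin 3),
    ← linearIndependent_equiv (finSuccAboveEquiv (0 : Fin 3)), e, LinearIndependent.pair_iff]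
  generalize p 1 - p 0 = x
  generalize p 2 - p 0 = y
  constructor
  · intro h h0
    have h1 := h y.re (-x.re) (by
      apply Complex.ext
      · simp; ring
      · simp; linarith)
    have h2 := h y.im (-x.im) (by
      apply Complex.ext
      · simp; linarith
      · simp; ring)
    have hx : x = 0 := Complex.ext (by simpa using h1.2) (by simpa using h2.2)
    simpa using h 1 0 (by simp [hx])
  · intro h0 s t h
    have hre := congrArg Complex.re h
    have him := congrArg Complex.im h
    simp only [Complex.add_re, Complex.add_im, Complex.real_smul, Complex.mul_re, Complex.mul_im,
      Complex.ofReal_re, Complex.ofReal_im, Complex.zero_re, Complex.zero_im, zero_mul, sub_zero,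
      add_zero] at hre him
    constructor
    · refine (mul_eq_zero.1 (?_ : s * (x.re * y.im - x.im * y.re) = 0)).resolve_right h0
      linear_combination y.im * hre - y.re * him
    · refine (mul_eq_zero.1 (?_ : t * (x.re * y.im - x.im * y.re) = 0)).resolve_right h0
      linear_combination x.re * him - x.im * hre

theorem IsConfiguration.affine {n : ℕ} {c : Placement n} (h : IsConfiguration c) {s : ℂ}
    (hs : s ≠ 0) (t : ℂ) : IsConfiguration fun i k => s * c i k + t := by
  refine isConfiguration_of_separated (fun i => ?_) (fun i j hij => ?_) fun i j hij => ?_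
  · have := h.nondegenerate i
    rw [affineIndependent_iff_cross] at this ⊢
    have e : ∀ k, s * c i k + t - (s * c i 0 + t) = s * (c i k - c i 0) := fun k => by ring
    rw [e, e]
    have h2 : Complex.normSq s ≠ 0 := by simpa using hs
    have := mul_ne_zero h2 this
    rw [Complex.normSq_apply] at this
    convert this using 1
    simp only [Complex.mul_re, Complex.mul_im]; ring
  · simp only [h.hinged i j hij]
  · exact (h.separated hij.ne).affine hs t

/-! ### Coordinates of the tight chain and local contact estimates -/

theorem tightSeven_apply (ℓ : ℝ) : tightSeven ℓ =
    ![![⟨0, -ℓ⟩, 0, ⟨-(√3 / 2) * ℓ, -ℓ / 2⟩],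
      ![0, ⟨0, ℓ⟩, ⟨-(√3 / 2) * ℓ, ℓ / 2⟩],
      ![⟨0, ℓ⟩, ⟨√3 / 2 * ℓ, ℓ / 2⟩, 0],
      ![⟨√3 / 2 * ℓ, ℓ / 2⟩, ⟨√3 / 2 * ℓ, -ℓ / 2⟩, 0],
      ![⟨√3 / 2 * ℓ, -ℓ / 2⟩, ⟨0, -ℓ⟩, 0],
      ![⟨0, -ℓ⟩, ⟨-(√3 / 2) * ℓ, -ℓ / 2⟩, ⟨-(√3 / 2) * ℓ, -3 * ℓ / 2⟩],
      ![⟨-(√3 / 2) * ℓ, -ℓ / 2⟩, 0, ⟨-(√3 / 2) * ℓ, ℓ / 2⟩]] := rfl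

theorem norm_eq_of_sq {z : ℂ} {r : ℝ} (hr : 0 ≤ r) (h : z.re ^ 2 + z.im ^ 2 = r ^ 2) :
    ‖z‖ = r := by
  rw [Complex.norm_eq_sqrt_sq_add_sq, h, Real.sqrt_sq hr]

theorem sq_of_norm_eq {z : ℂ} {r : ℝ} (h : ‖z‖ = r) : z.re ^ 2 + z.im ^ 2 = r ^ 2 := by
  rw [← h, Complex.sq_norm, Complex.normSq_apply]; ring

theorem norm_tightSeven_sub {ℓ : ℝ} (hℓ : 0 ≤ ℓ) (i : Fin 7) {j k : Fin 3} (hjk : j ≠ k) :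
    ‖tightSeven ℓ i j - tightSeven ℓ i k‖ = ℓ := by
  have h3 : √3 ^ 2 = 3 := Real.sq_sqrt (by norm_num)
  apply norm_eq_of_sq hℓ
  rw [tightSeven_apply]
  fin_cases i <;> fin_cases j <;> fin_cases k <;> first | exact absurd rfl hjk | skip
  all_goals simp
  all_goals ring_nf
  all_goals first | done | (rw [h3]; ring)

/-- If two triangles of a placement near `P`, `Q` are separated, where `P`, `Q` share a side and lie
on different sides of it, then the endpoints of the common side move apart, up to a small error. -/
theorem Separated.side_contact {p q P Q : Fin 3 → ℂ} (h : Separated p q) (e₁ e₂ f e₁' e₂' g : Fin 3)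
    {d : ℂ} (hp : ∀ k, ‖p k - P k‖ ≤ 1 / 100) (hq : ∀ k, ‖q k - Q k‖ ≤ 1 / 100)
    (h₁ : P e₁ = Q e₁') (h₂ : P e₂ = Q e₂') (hd : P e₂ - P e₁ = d) (hd1 : ‖d‖ = 1)
    (hg : Q g - P f = √3 * (I * d)) :
    -(|dot d (q e₁' - p e₁)| / 10) ≤ dot (I * d) (q e₁' - p e₁) ∧
    -(|dot d (q e₂' - p e₂)| / 10) ≤ dot (I * d) (q e₂' - p e₂) := by
  obtain ⟨n, hn, h⟩ := h
  have hp' : ∀ k, |dot n (p k - P k)| ≤ 1 / 100 := fun k =>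
    (abs_dot_le _ _).trans (by rw [hn, one_mul]; exact hp k)
  have hq' : ∀ k, |dot n (q k - Q k)| ≤ 1 / 100 := fun k =>
    (abs_dot_le _ _).trans (by rw [hn, one_mul]; exact hq k)
  simp only [dot_sub, abs_le] at hp' hq'
  have hD : dot n d = dot n (P e₂) - dot n (P e₁) := by rw [← hd, dot_sub]
  have hV : √3 * dot n (I * d) = dot n (Q g) - dot n (P f) := by
    rw [← dot_sub, hg]; simp [dot]; ring
  have s1 : 1 ≤ √3 := Real.one_le_sqrt.2 (by norm_num)
  -- Comparing opposite ends of the common side, in both orders, makes the normal almost orthogonal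
  -- to `d`; the apexes `f` and `g` then decide its sign, so it is nearly `I * d`.
  have hD1 : dot n d ≤ 1 / 50 := by
    rw [hD, h₁]
    linarith [h e₂ e₁', (hp' e₂).1, (hq' e₁').2, congrArg (dot n) h₁, congrArg (dot n) h₂]
  have hD2 : -(1 / 50) ≤ dot n d := by
    rw [hD, h₂]
    linarith [h e₁ e₂', (hp' e₁).1, (hq' e₂').2, congrArg (dot n) h₁, congrArg (dot n) h₂]
  have hV1 : -(1 / 50) ≤ √3 * dot n (I * d) := by
    rw [hV]
    linarith [h f g, (hp' f).1, (hq' g).2]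
  have hd2 := sq_of_norm_eq hd1
  have hn2 := sq_of_norm_eq hn
  have hDV : dot n d ^ 2 + dot n (I * d) ^ 2 = 1 := by
    have : dot n d ^ 2 + dot n (I * d) ^ 2 = (n.re ^ 2 + n.im ^ 2) * (d.re ^ 2 + d.im ^ 2) := by
      simp [dot]; ring
    rw [this, hd2, hn2]; norm_num
  have hV2 : 1 / 2 ≤ dot n (I * d) := by
    by_contra hlt
    push Not at hlt
    have : -(1 / 50) ≤ dot n (I * d) := by
      by_contra hlt'
      push Not at hlt'
      nlinarith
    nlinarith
  have key : ∀ z, 0 ≤ dot n z → -(|dot d z| / 10) ≤ dot (I * d) z := by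
    intro z hz
    have e : dot n z = dot n d * dot d z + dot n (I * d) * dot (I * d) z := by
      have : dot n d * dot d z + dot n (I * d) * dot (I * d) z =
          (d.re ^ 2 + d.im ^ 2) * dot n z := by
        simp [dot]; ring
      rw [this, hd2]; ring
    rw [e] at hz
    by_contra hlt
    push Not at hlt
    have h1 : dot n d * dot d z ≤ 1 / 50 * |dot d z| := by
      refine (le_abs_self _).trans ?_
      rw [abs_mul]
      exact mul_le_mul_of_nonneg_right (abs_le.2 ⟨hD2, hD1⟩) (abs_nonneg _)
    have := abs_nonneg (dot d z)
    nlinarith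
  exact ⟨key _ (by rw [dot_sub]; linarith [h e₁ e₁']), key _ (by rw [dot_sub]; linarith [h e₂ e₂'])⟩

/-- A vector that lies, up to a small error, in a wedge of angle `60°` is close to its axis. -/
theorem wedge_bound {S N : ℝ} (h₁ : -(|S| / 10) ≤ N)
    (h₂ : -(|S / 2 + √3 / 2 * N| / 10) ≤ √3 / 2 * S - N / 2) : |N| ≤ 3 * S := by
  have a1 : 1.7 ≤ √3 := Real.le_sqrt_of_sq_le (by norm_num)
  have a2 : √3 ≤ 1.8 := Real.sqrt_le_iff.2 (by norm_num)
  rcases abs_cases S with ⟨e1, _⟩ | ⟨e1, _⟩ <;> rcases abs_cases N with ⟨e2, _⟩ | ⟨e2, _⟩ <;>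
    rcases abs_cases (S / 2 + √3 / 2 * N) with ⟨e3, _⟩ | ⟨e3, _⟩ <;> rw [e1] at h₁ <;>
    rw [e3] at h₂ <;> rw [e2] <;> nlinarith

/-- Two triangles hinged together along a common side can only open. -/
theorem hinge_opens {n e P : ℂ} (hn : n ≠ 0) (he : e ≠ 0) (h₁ : dot n e ≤ 0)
    (h₂ : 0 ≤ dot n (e * P))
    (h₃ : 0 ≤ dot n (e * P * ⟨1 / 2, √3 / 2⟩)) (hP : ‖P - 1‖ ≤ 1 / 10) : 0 ≤ P.im := by
  have a1 : 1.7 ≤ √3 := Real.le_sqrt_of_sq_le (by norm_num)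
  have hre := (Complex.abs_re_le_norm (P - 1)).trans hP
  have him := (Complex.abs_im_le_norm (P - 1)).trans hP
  rw [abs_le] at hre him
  simp only [Complex.sub_re, Complex.sub_im, Complex.one_re, Complex.one_im, sub_zero] at hre him
  obtain ⟨v, hv⟩ : ∃ v : ℂ, v = starRingEnd ℂ e * n := ⟨_, rfl⟩
  have hv0 : v ≠ 0 := by
    rw [hv]; exact mul_ne_zero (by simpa using he) hn
  have hdot : ∀ z, dot n (e * z) = dot v z := fun z => by rw [hv]; simp [dot]; ring
  rw [mul_assoc, hdot] at h₃
  rw [hdot] at h₂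
  rw [← mul_one e, hdot] at h₁
  simp [dot] at h₁ h₂ h₃
  -- In the frame where `e` is 1 and `n` becomes `v`: if `P` turned clockwise, both coordinates of
  -- `v` would be nonpositive, while `P` turned by 60° has both coordinates at least 1/10. The last
  -- inequality would force `v = 0`.
  by_contra hlt
  push Not at hlt
  have hv2 : v.im ≤ 0 := by
    by_contra hpos
    push Not at hpos
    nlinarith [mul_pos hpos (neg_pos.2 hlt)]
  have c1 : 1 / 10 ≤ P.re * (1 / 2) - P.im * (√3 / 2) := by nlinarith
  have c2 : 1 / 10 ≤ P.re * (√3 / 2) + P.im * (1 / 2) := by nlinarith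
  have h5 : 1 / 10 * (v.re + v.im) ≥ 0 := by
    norm_num at h₃ c1 c2 ⊢
    nlinarith [mul_le_mul_of_nonneg_left c1 (neg_nonneg.2 h₁),
      mul_le_mul_of_nonneg_left c2 (neg_nonneg.2 hv2)]
  exact hv0 (Complex.ext (by simp; linarith) (by simp; linarith))

theorem eq_zero_of_dot {d y : ℂ} (hd : ‖d‖ = 1) (h₁ : dot d y = 0) (h₂ : |dot (I * d) y| ≤ 0) :
    y = 0 := by
  replace h₂ := abs_nonpos_iff.1 h₂
  replace hd := sq_of_norm_eq hd
  simp [dot] at h₁ h₂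
  apply Complex.ext
  · simp; linear_combination d.re * h₁ - d.im * h₂ - y.re * hd
  · simp; linear_combination d.im * h₁ + d.re * h₂ - y.im * hd

/-- The unit circle about (-1, 0) is tangent to the line D = 0 at the origin, whereas the wedge
leaves the origin transversally to that line; so they do not meet again close to it. -/
theorem eq_zero_of_circle_wedge {D M : ℝ} (h : D ^ 2 + M ^ 2 = -2 * D) (hM : |M| ≤ 3 * -D)
    (hD : -(1 / 50) ≤ D) : D = 0 := by
  have h1 : M ^ 2 ≤ (3 * -D) ^ 2 := sq_le_sq' (by linarith [neg_abs_le M]) (by linarith [le_abs_self M])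
  have h2 : D ≤ 0 := by linarith [abs_nonneg M]
  have h3 : 0 ≤ D * (10 * D + 2) := by linarith
  exact le_antisymm h2 (nonneg_of_mul_nonneg_left h3 (by linarith))

/-! ### Isolation of the tight chain -/

set_option maxHeartbeats 800000 in
/-- In a configuration near the tight one, the last two triangles cannot move relative to the first. -/
theorem pinned_vertices {x : Placement 7} (h0 : x 0 = tightSeven 1 0)
    (hh : ∀ i j : Fin 7, (j : ℕ) = i + 1 → x i 1 = x j 0)
    (hs : ∀ i j, i ≠ j → Separated (x i) (x j))
    (hr : ∀ i, RigidlyMoved (tightSeven 1 i) (x i))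
    (near : ∀ i k, ‖x i k - tightSeven 1 i k‖ ≤ 1 / 100) :
    x 4 1 = ⟨0, -1⟩ ∧ x 5 1 = ⟨-(√3 / 2), -1 / 2⟩ ∧ x 6 1 = 0 := by
  have h3 : √3 ^ 2 = 3 := Real.sq_sqrt (by norm_num)
  have x00 : x 0 0 = ⟨0, -1⟩ := by rw [h0]; simp [tightSeven_apply]
  have x01 : x 0 1 = 0 := by rw [h0]; simp [tightSeven_apply]
  have x02 : x 0 2 = ⟨-(√3 / 2), -1 / 2⟩ := by rw [h0]; simp [tightSeven_apply]
  have x10 : x 1 0 = 0 := by rw [← hh 0 1 rfl, x01]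
  have x50 : x 5 0 = x 4 1 := (hh 4 5 rfl).symm
  have x60 : x 6 0 = x 5 1 := (hh 5 6 rfl).symm
  have len : ∀ i j k, j ≠ k → ‖x i j - x i k‖ = 1 := by
    intro i j k hjk
    obtain ⟨A, B, hA, hx⟩ := hr i
    rw [hx, hx, show A * tightSeven 1 i j + B - (A * tightSeven 1 i k + B) =
      A * (tightSeven 1 i j - tightSeven 1 i k) by ring, norm_mul, hA,
      norm_tightSeven_sub zero_le_one i hjk, one_mul]
  have c04 := (hs 0 4 (by decide)).side_contact 1 0 2 2 1 0 (d := -I) (near 0) (near 4)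
    (by simp [tightSeven_apply]) (by simp [tightSeven_apply])
    (by simp [tightSeven_apply, Complex.ext_iff]) (by simp)
    (by simp [tightSeven_apply, Complex.ext_iff])
  have c05 := (hs 0 5 (by decide)).side_contact 0 2 1 0 1 2 (d := ⟨-(√3 / 2), 1 / 2⟩)
    (near 0) (near 5)
    (by simp [tightSeven_apply]) (by simp [tightSeven_apply])
    (by simp [tightSeven_apply, Complex.ext_iff]; norm_num)
    (norm_eq_of_sq zero_le_one (by simp; linarith))
    (by simp [tightSeven_apply, Complex.ext_iff]; constructor <;> linarith)
  have c06 := (hs 0 6 (by decide)).side_contact 2 1 0 0 1 2 (d := ⟨√3 / 2, 1 / 2⟩)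
    (near 0) (near 6)
    (by simp [tightSeven_apply]) (by simp [tightSeven_apply])
    (by simp [tightSeven_apply, Complex.ext_iff]; norm_num)
    (norm_eq_of_sq zero_le_one (by simp; linarith))
    (by simp [tightSeven_apply, Complex.ext_iff]; constructor <;> linarith)
  have c16 := (hs 1 6 (by decide)).side_contact 0 2 1 1 2 0 (d := ⟨-(√3 / 2), 1 / 2⟩)
    (near 1) (near 6)
    (by simp [tightSeven_apply]) (by simp [tightSeven_apply])
    (by simp [tightSeven_apply])
    (norm_eq_of_sq zero_le_one (by simp; linarith))
    (by simp [tightSeven_apply, Complex.ext_iff]; constructor <;> linarith)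
  replace c04 := c04.2
  replace c16 := c16.1
  obtain ⟨c05z, c05w⟩ := c05
  obtain ⟨c06w, c06v⟩ := c06
  rw [x00, x50] at c05z
  rw [x00] at c04
  rw [x02] at c05w
  rw [x02, x60] at c06w
  rw [x01] at c06v
  rw [x10] at c16
  have l5 := sq_of_norm_eq (len 5 0 1 (by decide))
  have l6 := sq_of_norm_eq (len 6 0 1 (by decide))
  rw [x50] at l5
  rw [x60] at l6
  have nm := (Complex.abs_re_le_norm _).trans (near 6 1)
  have nm' := (Complex.abs_im_le_norm _).trans (near 6 1)
  generalize x 4 1 = a at *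
  generalize x 5 1 = p at *
  generalize x 6 1 = m at *
  obtain ⟨z, rfl⟩ : ∃ z, a = z + ⟨0, -1⟩ := ⟨a - ⟨0, -1⟩, by ring⟩
  obtain ⟨w, rfl⟩ : ∃ w, p = w + ⟨-(√3 / 2), -1 / 2⟩ := ⟨p - ⟨-(√3 / 2), -1 / 2⟩, by ring⟩
  rw [add_sub_cancel_right] at c04 c05z c05w c06w
  rw [sub_zero] at c06v c16
  -- Each displacement is confined by two side contacts at its vertex: `z` at a by am and ap, `w` at
  -- p by ap and pm, `m` by pm and mq.
  have wz := wedge_bound (S := -dot ⟨-(√3 / 2), 1 / 2⟩ z) (N := dot (I * ⟨-(√3 / 2), 1 / 2⟩) z)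
    (by rw [abs_neg]; exact c05z) (by
      convert c04 using 1
      · congr 3; simp [dot]; linear_combination (-z.im / 4) * h3
      · simp [dot]; linear_combination (z.re / 4) * h3)
  have ww := wedge_bound (S := dot ⟨-(√3 / 2), 1 / 2⟩ w) (N := dot (I * ⟨-(√3 / 2), 1 / 2⟩) w)
    c05w (by
      convert c06w using 1
      · rw [← abs_neg]; congr 3; simp [dot]; linear_combination (w.im / 4) * h3
      · simp [dot]; linear_combination (-w.re / 4) * h3)
  have wv := wedge_bound (S := -dot ⟨√3 / 2, 1 / 2⟩ m) (N := dot (I * ⟨√3 / 2, 1 / 2⟩) m)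
    (by rw [abs_neg]; exact c06v) (by
      convert c16 using 1
      · congr 3; simp [dot]; linear_combination (m.im / 4) * h3
      · simp [dot]; linear_combination (-m.re / 4) * h3)
  have Sz : 0 ≤ -dot ⟨-(√3 / 2), 1 / 2⟩ z := by linarith [abs_nonneg (dot (I * ⟨-(√3 / 2), 1 / 2⟩) z)]
  have Sw : 0 ≤ dot ⟨-(√3 / 2), 1 / 2⟩ w := by linarith [abs_nonneg (dot (I * ⟨-(√3 / 2), 1 / 2⟩) w)]
  -- With d the direction from a to p, the bar length |d + w - z| = 1 gives 2 d·(w - z) = -|w - z|²,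
  -- against `Sz` and `Sw`.
  have hsum : dot ⟨-(√3 / 2), 1 / 2⟩ w - dot ⟨-(√3 / 2), 1 / 2⟩ z ≤ 0 := by
    simp at l5
    simp [dot]
    linarith [sq_nonneg (z.re - w.re), sq_nonneg (z.im - w.im)]
  have nd : ‖(⟨-(√3 / 2), 1 / 2⟩ : ℂ)‖ = 1 := norm_eq_of_sq zero_le_one (by simp; linarith)
  have nd' : ‖(⟨√3 / 2, 1 / 2⟩ : ℂ)‖ = 1 := norm_eq_of_sq zero_le_one (by simp; linarith)
  have z0 : z = 0 := eq_zero_of_dot nd (by linarith) (by linarith)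
  have w0 : w = 0 := eq_zero_of_dot nd (by linarith) (by linarith)
  subst z0 w0
  have m0 : m = 0 := by
    have hm : dot ⟨√3 / 2, 1 / 2⟩ m ^ 2 + dot (I * ⟨√3 / 2, 1 / 2⟩) m ^ 2 =
        -2 * dot ⟨√3 / 2, 1 / 2⟩ m := by
      simp at l6
      simp [dot]
      linear_combination l6 + ((m.re ^ 2 + m.im ^ 2 - 1) / 4) * h3
    have small : |dot ⟨√3 / 2, 1 / 2⟩ m| ≤ 1 / 50 := by
      have := (abs_dot_le ⟨√3 / 2, 1 / 2⟩ m)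
      rw [nd', one_mul] at this
      have := Complex.norm_le_abs_re_add_abs_im m
      simp [tightSeven_apply] at nm nm'
      linarith
    rw [abs_le] at small
    have h1 := eq_zero_of_circle_wedge hm wv small.1
    exact eq_zero_of_dot nd' h1 (by rw [h1] at wv; simpa using wv)
  simp [m0]

/-- If a chain of three unit bars with turning angles at most `60°` spans a distance of at most `2`,
then both angles are `60°`. -/
theorem arm_straight {P Q : ℂ} (hP : ‖P‖ = 1) (hQ : ‖Q‖ = 1) (hP1 : 0 ≤ P.im) (hQ1 : 0 ≤ Q.im)
    (hP2 : 0 ≤ P.re) (hQ2 : 0 ≤ Q.re)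
    (h : ‖starRingEnd ℂ P * ⟨√3 / 2, -1 / 2⟩ + ⟨0, -1⟩ + Q * ⟨-(√3 / 2), -1 / 2⟩‖ ≤ 2) :
    P = 1 ∧ Q = 1 := by
  have a1 : 1.7 ≤ √3 := Real.le_sqrt_of_sq_le (by norm_num)
  have h1 := (Complex.abs_im_le_norm _).trans h
  have h2 := (abs_le.1 h1).1
  have hP := sq_of_norm_eq hP
  have hQ := sq_of_norm_eq hQ
  simp at h2
  -- On the unit circle in the closed first quadrant, the coordinates add up to at least 1. Opening
  -- a hinge therefore lengthens the vertical span by at least (√3 - 1)/2 times the imaginary part.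
  have cP : 1 - P.re ≤ P.im := by nlinarith
  have cQ : 1 - Q.re ≤ Q.im := by nlinarith
  have hs : P.im + Q.im ≤ 0 := by nlinarith
  have hP0 : P.im = 0 := by linarith
  have hQ0 : Q.im = 0 := by linarith
  rw [hP0] at hP cP
  rw [hQ0] at hQ cQ
  refine ⟨Complex.ext ?_ hP0, Complex.ext ?_ hQ0⟩
  · simp; nlinarith
  · simp; nlinarith

theorem rotation_eq_one {A d : ℂ} (hd : d ≠ 0) (h : A * d = d) : A = 1 :=
  mul_right_cancel₀ hd (by rw [h, one_mul])

set_option maxHeartbeats 800000 in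
/-- A configuration near the tight one, with the first triangle fixed, is the tight one. -/
theorem eq_tightSeven_of_near {x : Placement 7} (h0 : x 0 = tightSeven 1 0)
    (hh : ∀ i j : Fin 7, (j : ℕ) = i + 1 → x i 1 = x j 0)
    (hs : ∀ i j, i ≠ j → Separated (x i) (x j))
    (hr : ∀ i, RigidlyMoved (tightSeven 1 i) (x i))
    (near : ∀ i k, ‖x i k - tightSeven 1 i k‖ ≤ 1 / 100) : x = tightSeven 1 := by
  obtain ⟨x41, x51, x61⟩ := pinned_vertices h0 hh hs hr near
  have h3 : √3 ^ 2 = 3 := Real.sq_sqrt (by norm_num)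
  choose A B hA hx using hr
  have hdiff : ∀ i j k, x i j - x i k = A i * (tightSeven 1 i j - tightSeven 1 i k) :=
    fun i j k => by rw [hx, hx]; ring
  have hA1 : ∀ i, ‖A i - 1‖ ≤ 1 / 50 := by
    intro i
    have e : (A i - 1) * (tightSeven 1 i 1 - tightSeven 1 i 0) =
        (x i 1 - tightSeven 1 i 1) - (x i 0 - tightSeven 1 i 0) := by
      linear_combination -hdiff i 1 0
    have := congrArg norm e
    rw [norm_mul, norm_tightSeven_sub zero_le_one i (by decide), mul_one] at this
    rw [this]
    exact (norm_sub_le _ _).trans (by linarith [near i 1, near i 0])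
  have fixed : ∀ i, A i = 1 → ∀ k, x i k = tightSeven 1 i k → x i = tightSeven 1 i := by
    intro i h1 k hk
    funext j
    have := hdiff i j k
    rw [h1, hk] at this
    linear_combination this
  have fixed₂ : ∀ i, x i 0 = tightSeven 1 i 0 → x i 1 = tightSeven 1 i 1 →
      x i = tightSeven 1 i := by
    intro i h1 h2
    refine fixed i (rotation_eq_one ?_ ((hdiff i 1 0).symm.trans (by rw [h1, h2]))) 0 h1
    rw [← norm_pos_iff, norm_tightSeven_sub zero_le_one i (by decide)]
    exact one_pos
  have x5 : x 5 = tightSeven 1 5 := fixed₂ 5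
    (by rw [← hh 4 5 rfl, x41]; simp [tightSeven_apply]) (by rw [x51]; simp [tightSeven_apply])
  have x6 : x 6 = tightSeven 1 6 := fixed₂ 6
    (by rw [← hh 5 6 rfl, x51]; simp [tightSeven_apply]) (by rw [x61]; simp [tightSeven_apply])
  have x10 : x 1 0 = tightSeven 1 1 0 := by
    rw [← hh 0 1 rfl, h0]; simp [tightSeven_apply]
  -- The number `conj (A i) * A j` is the rotation of triangle `j` relative to triangle `i`; it is
  -- applied to the hinges r and s, where the two apexes coincide at m.
  have opens : ∀ i j : Fin 7, (j : ℕ) = i + 1 →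
      tightSeven 1 j 2 - tightSeven 1 j 0 = tightSeven 1 i 2 - tightSeven 1 i 1 →
      tightSeven 1 j 1 - tightSeven 1 j 0 =
        (tightSeven 1 i 2 - tightSeven 1 i 1) * ⟨1 / 2, √3 / 2⟩ →
      0 ≤ (starRingEnd ℂ (A i) * A j).im ∧ ‖starRingEnd ℂ (A i) * A j - 1‖ ≤ 1 / 10 := by
    intro i j hij e1 e2
    have hcc : A i * starRingEnd ℂ (A i) = 1 := by
      rw [Complex.mul_conj, Complex.normSq_eq_norm_sq, hA]; norm_num
    have hP : ‖starRingEnd ℂ (A i) * A j - 1‖ ≤ 1 / 10 := by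
      have e : starRingEnd ℂ (A i) * A j - 1 = starRingEnd ℂ (A i) * ((A j - 1) - (A i - 1)) := by
        linear_combination hcc
      rw [e, norm_mul, Complex.norm_conj, hA, one_mul]
      exact (norm_sub_le _ _).trans (by linarith [hA1 i, hA1 j])
    refine ⟨?_, hP⟩
    have hne : i ≠ j := by rintro rfl; omega
    obtain ⟨n, hn, hsep⟩ := hs i j hne
    have hin := hh i j hij
    have hcP : ∀ z, A i * z * (starRingEnd ℂ (A i) * A j) = A j * z := fun z => by
      linear_combination z * A j * hcc
    have hAi : A i ≠ 0 := by rw [← norm_pos_iff, hA]; exact one_pos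
    have hg : tightSeven 1 i 2 - tightSeven 1 i 1 ≠ 0 := by
      rw [← norm_pos_iff, norm_tightSeven_sub zero_le_one i (by decide)]; exact one_pos
    refine hinge_opens (n := n) (e := A i * (tightSeven 1 i 2 - tightSeven 1 i 1))
      (by rintro rfl; simp at hn) (mul_ne_zero hAi hg) ?_ ?_ ?_ hP
    · rw [← hdiff, dot_sub, hin]; linarith [hsep 2 0]
    · rw [hcP, ← e1, ← hdiff, dot_sub, ← hin]; linarith [hsep 1 2]
    · rw [hcP, mul_assoc, ← e2, ← hdiff, dot_sub, ← hin]; linarith [hsep 1 1]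
  obtain ⟨hP1, hP2⟩ := opens 2 3 rfl (by simp [tightSeven_apply])
    (by simp [tightSeven_apply, Complex.ext_iff]; constructor <;> linarith)
  obtain ⟨hQ1, hQ2⟩ := opens 3 4 rfl (by simp [tightSeven_apply])
    (by simp [tightSeven_apply, Complex.ext_iff]; constructor <;> linarith)
  have hcc : A 3 * starRingEnd ℂ (A 3) = 1 := by
    rw [Complex.mul_conj, Complex.normSq_eq_norm_sq, hA]; norm_num
  have hb : ‖x 1 1 - 0‖ = 1 := by
    rw [show (0 : ℂ) = x 1 0 by rw [x10]; simp [tightSeven_apply], hdiff, norm_mul, hA,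
      norm_tightSeven_sub zero_le_one 1 (by decide), one_mul]
  have span : ⟨0, -1⟩ - x 1 1 = A 3 * (starRingEnd ℂ (starRingEnd ℂ (A 2) * A 3) *
      ⟨√3 / 2, -1 / 2⟩ + ⟨0, -1⟩ + starRingEnd ℂ (A 3) * A 4 * ⟨-(√3 / 2), -1 / 2⟩) := by
    have d2 := hdiff 2 1 0
    have d3 := hdiff 3 1 0
    have d4 := hdiff 4 1 0
    rw [hh 2 3 rfl, ← hh 1 2 rfl, show tightSeven 1 2 1 - tightSeven 1 2 0 =
      ⟨√3 / 2, -1 / 2⟩ by simp [tightSeven_apply, Complex.ext_iff]; norm_num] at d2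
    rw [hh 3 4 rfl, show tightSeven 1 3 1 - tightSeven 1 3 0 =
      ⟨0, -1⟩ by simp [tightSeven_apply, Complex.ext_iff]; norm_num] at d3
    rw [x41, show tightSeven 1 4 1 - tightSeven 1 4 0 =
      ⟨-(√3 / 2), -1 / 2⟩ by simp [tightSeven_apply, Complex.ext_iff]; norm_num] at d4
    rw [map_mul, Complex.conj_conj]
    linear_combination d2 + d3 + d4 -
      (A 2 * ⟨√3 / 2, -1 / 2⟩ + A 4 * ⟨-(√3 / 2), -1 / 2⟩) * hcc
  have hP3 := abs_le.1 ((Complex.abs_re_le_norm _).trans hP2)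
  have hQ3 := abs_le.1 ((Complex.abs_re_le_norm _).trans hQ2)
  rw [Complex.sub_re, Complex.one_re] at hP3 hQ3
  -- The bound 2 on the span is the triangle inequality through m = 0, at distance 1 from both a and
  -- b.
  obtain ⟨P1, Q1⟩ := arm_straight (by rw [norm_mul, Complex.norm_conj, hA, hA, one_mul])
    (by rw [norm_mul, Complex.norm_conj, hA, hA, one_mul]) hP1 hQ1
    (by linarith) (by linarith) (by
      have := congrArg norm span
      rw [norm_mul, hA, one_mul] at this
      rw [← this]
      refine (norm_sub_le _ _).trans ?_
      rw [sub_zero] at hb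
      rw [hb, norm_eq_of_sq (r := 1) zero_le_one (by simp)]
      norm_num)
  have hA2 : A 2 = A 3 := by
    have := congrArg (starRingEnd ℂ) P1
    rw [map_mul, Complex.conj_conj, map_one] at this
    linear_combination A 3 * this - A 2 * hcc
  have hA4 : A 4 = A 3 := by
    linear_combination A 3 * Q1 - A 4 * hcc
  have hb' : x 1 1 = ⟨0, -1⟩ + A 3 * ⟨0, 2⟩ := by
    rw [P1, Q1, map_one, one_mul, one_mul] at span
    have e : (⟨√3 / 2, -1 / 2⟩ : ℂ) + ⟨0, -1⟩ + ⟨-(√3 / 2), -1 / 2⟩ = -⟨0, 2⟩ := by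
      simp [Complex.ext_iff]; norm_num
    rw [e] at span
    linear_combination -span
  -- The arm now turns rigidly about a, so b = a + 2i·`A 3`; being at distance 1 from m forces the
  -- real part of `A 3` to be 1.
  have hA3 : A 3 = 1 := by
    have h1 := sq_of_norm_eq hb
    have h2 := sq_of_norm_eq (hA 3)
    rw [hb'] at h1
    simp at h1
    have h3 : (A 3).re = 1 := by linarith
    exact Complex.ext h3 (by rw [h3] at h2; simpa using h2)
  rw [hA3] at hA2 hA4 hb'
  have x1 : x 1 = tightSeven 1 1 := fixed₂ 1 x10
    (by rw [hb']; simp [tightSeven_apply, Complex.ext_iff]; norm_num)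
  have x2 : x 2 = tightSeven 1 2 := fixed 2 hA2 0
    (by rw [← hh 1 2 rfl, x1]; simp [tightSeven_apply])
  have x3 : x 3 = tightSeven 1 3 := fixed 3 hA3 0
    (by rw [← hh 2 3 rfl, x2]; simp [tightSeven_apply])
  have x4 : x 4 = tightSeven 1 4 := fixed 4 hA4 0
    (by rw [← hh 3 4 rfl, x3]; simp [tightSeven_apply])
  funext i
  fin_cases i <;> assumption

/-! ### Rigid motions and general side length -/

theorem tightSeven_eq_mul (ℓ : ℝ) (i : Fin 7) (k : Fin 3) :
    tightSeven ℓ i k = ℓ * tightSeven 1 i k := by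
  rw [tightSeven_apply, tightSeven_apply]
  fin_cases i <;> fin_cases k <;> simp [Complex.ext_iff] <;> (try constructor) <;> ring

theorem norm_tightSeven_le (i : Fin 7) (k : Fin 3) : ‖tightSeven 1 i k‖ ≤ 2 := by
  have h3 : √3 ^ 2 = 3 := Real.sq_sqrt (by norm_num)
  rw [Complex.norm_eq_sqrt_sq_add_sq, Real.sqrt_le_left (by norm_num), tightSeven_apply]
  fin_cases i <;> fin_cases k <;> simp <;> ring_nf <;> (try rw [h3]) <;> norm_num

theorem IsConfiguration.ne {n : ℕ} {c : Placement n} (h : IsConfiguration c) (i : Fin n)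
    {j k : Fin 3} (hjk : j ≠ k) : c i j ≠ c i k :=
  fun e => hjk ((h.nondegenerate i).injective e)

theorem RigidlyMoved.comp {ι : Type*} {p q r : ι → ℂ} (h₁ : RigidlyMoved p q)
    (h₂ : RigidlyMoved q r) : RigidlyMoved p r := by
  obtain ⟨a, b, ha, h⟩ := h₁
  obtain ⟨a', b', ha', h'⟩ := h₂
  exact ⟨a' * a, a' * b + b', by rw [norm_mul, ha, ha', one_mul], fun k => by rw [h', h]; ring⟩

theorem RigidlyMoved.eq_of_two {ι : Type*} {p q : ι → ℂ} (h : RigidlyMoved p q) {j k : ι}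
    (hne : p j ≠ p k) (hj : q j = p j) (hk : q k = p k) : q = p := by
  obtain ⟨a, b, -, h⟩ := h
  have ha : a = 1 := by
    refine mul_right_cancel₀ (sub_ne_zero.2 hne) ?_
    linear_combination h k - h j + hj - hk
  funext l
  have h1 := h j
  rw [hj, ha] at h1
  rw [h, ha]
  linear_combination -h1

/-- The complex ratio of two sides determines a triangle up to orientation-preserving similarity.
Cross-multiplied, it becomes a closed condition without an existential quantifier. -/
theorem rigidlyMoved_of_triangle {p q : Fin 3 → ℂ} (hne : p 0 ≠ p 1)
    (h₁ : ‖q 1 - q 0‖ = ‖p 1 - p 0‖)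
    (h₂ : (q 2 - q 0) * (p 1 - p 0) = (p 2 - p 0) * (q 1 - q 0)) : RigidlyMoved p q := by
  have hne' := sub_ne_zero.2 hne.symm
  refine ⟨(q 1 - q 0) / (p 1 - p 0), q 0 - (q 1 - q 0) / (p 1 - p 0) * p 0, ?_, fun k => ?_⟩
  · rw [norm_div, h₁, div_self (norm_ne_zero_iff.2 hne')]
  · fin_cases k
    · simp
    · simp only [Fin.mk_one]
      field_simp
      ring
    · simp only [Fin.reduceFinMk]
      field_simp
      linear_combination h₂

theorem RigidlyMoved.triangle {p q : Fin 3 → ℂ} (h : RigidlyMoved p q) :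
    ‖q 1 - q 0‖ = ‖p 1 - p 0‖ ∧
      (q 2 - q 0) * (p 1 - p 0) = (p 2 - p 0) * (q 1 - q 0) := by
  obtain ⟨a, b, ha, h⟩ := h
  rw [h, h, h, show a * p 1 + b - (a * p 0 + b) = a * (p 1 - p 0) by ring, norm_mul, ha, one_mul]
  exact ⟨rfl, by ring⟩

/-- The seven-triangle chain is isolated, up to rigid motions, in its configuration space. -/
theorem rigidlyMoved_tightSeven_of_near {ℓ : ℝ} (hℓ : 0 < ℓ) {x : Placement 7}
    (hh : ∀ i j : Fin 7, (j : ℕ) = i + 1 → x i 1 = x j 0)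
    (hs : ∀ i j, i ≠ j → Separated (x i) (x j))
    (hr : ∀ i, RigidlyMoved (tightSeven ℓ i) (x i))
    (near : ∀ i k, ‖x i k - tightSeven ℓ i k‖ ≤ ℓ / 1000) :
    ∃ a b : ℂ, ‖a‖ = 1 ∧ ∀ i k, x i k = a * tightSeven ℓ i k + b := by
  have hℓ' : (ℓ : ℂ) ≠ 0 := by exact_mod_cast hℓ.ne'
  obtain ⟨A, B, hA, hx0⟩ := hr 0
  have hA0 : A ≠ 0 := by rw [← norm_pos_iff, hA]; exact one_pos
  have hs0 : ((ℓ : ℂ) * A)⁻¹ ≠ 0 := inv_ne_zero (mul_ne_zero hℓ' hA0)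
  have hA1 : ‖A - 1‖ ≤ 2 / 1000 := by
    have e : (A - 1) * (tightSeven ℓ 0 1 - tightSeven ℓ 0 0) =
        (x 0 1 - tightSeven ℓ 0 1) - (x 0 0 - tightSeven ℓ 0 0) := by
      rw [hx0, hx0]; ring
    have := congrArg norm e
    rw [norm_mul, norm_tightSeven_sub hℓ.le 0 (by decide)] at this
    have h2 := norm_sub_le (x 0 1 - tightSeven ℓ 0 1) (x 0 0 - tightSeven ℓ 0 0)
    rw [← this] at h2
    nlinarith [near 0 1, near 0 0]
  have key : (fun i k => (ℓ * A)⁻¹ * x i k + (-((ℓ * A)⁻¹ * B))) = tightSeven 1 := by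
    refine eq_tightSeven_of_near ?_ ?_ ?_ ?_ ?_
    · funext k
      rw [hx0, tightSeven_eq_mul]
      field_simp
      ring
    · intro i j hij
      simp only [hh i j hij]
    · exact fun i j hij => (hs i j hij).affine hs0 _
    · intro i
      obtain ⟨a, b, ha, h⟩ := hr i
      refine ⟨A⁻¹ * a, (ℓ * A)⁻¹ * (b - B), by rw [norm_mul, norm_inv, hA, ha]; norm_num,
        fun k => ?_⟩
      simp only [h, tightSeven_eq_mul ℓ]
      field_simp
      ring
    · intro i k
      have e : (ℓ * A)⁻¹ * x i k + (-((ℓ * A)⁻¹ * B)) - tightSeven 1 i k =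
          (ℓ * A)⁻¹ * ((x i k - tightSeven ℓ i k) - (x 0 0 - tightSeven ℓ 0 0) -
            (A - 1) * (ℓ * (tightSeven 1 i k - tightSeven 1 0 0))) := by
        rw [hx0 0, tightSeven_eq_mul ℓ, tightSeven_eq_mul ℓ]
        field_simp
        ring
      rw [e, norm_mul, norm_inv, norm_mul, hA, mul_one, Complex.norm_real, Real.norm_eq_abs,
        abs_of_pos hℓ, inv_mul_le_iff₀ hℓ]
      refine (norm_sub_le _ _).trans ?_
      -- In units of `ℓ` the errors add up to 1/1000 + 1/1000 + 4 · 2/1000 = 1/100, the tolerance of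
      -- the normalized statement.
      have h1 := (norm_sub_le (x i k - tightSeven ℓ i k) (x 0 0 - tightSeven ℓ 0 0)).trans
        (add_le_add (near i k) (near 0 0))
      have h2 : ‖tightSeven 1 i k - tightSeven 1 0 0‖ ≤ 4 := (norm_sub_le _ _).trans
        (by linarith [norm_tightSeven_le i k, norm_tightSeven_le 0 0])
      have h3 : ‖(A - 1) * (ℓ * (tightSeven 1 i k - tightSeven 1 0 0))‖ ≤ 2 / 1000 * (ℓ * 4) := by
        rw [norm_mul, norm_mul, Complex.norm_real, Real.norm_eq_abs, abs_of_pos hℓ]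
        gcongr
      linarith
  refine ⟨A, B, hA, fun i k => ?_⟩
  have := congrFun (congrFun key i) k
  beta_reduce at this
  rw [tightSeven_eq_mul, ← this]
  field_simp
  ring

/-! ### From isolation to strong locking by compactness -/

theorem isClosed_separated : IsClosed {v : (Fin 3 → ℂ) × (Fin 3 → ℂ) | Separated v.1 v.2} := by
  have e : {v : (Fin 3 → ℂ) × (Fin 3 → ℂ) | Separated v.1 v.2} =
      Prod.snd '' {w : Metric.sphere (0 : ℂ) 1 × ((Fin 3 → ℂ) × (Fin 3 → ℂ)) |
        ∀ k l, dot w.1 (w.2.1 k) ≤ dot w.1 (w.2.2 l)} := by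
    ext v
    constructor
    · rintro ⟨n, hn, h⟩
      exact ⟨(⟨n, by simpa using hn⟩, v), h, rfl⟩
    · rintro ⟨⟨n, v⟩, h, rfl⟩
      exact ⟨n, by simp, h⟩
  rw [e]
  apply isClosedMap_snd_of_compactSpace
  simp only [Set.ofPred_forall]
  refine isClosed_iInter fun k => isClosed_iInter fun l => isClosed_le ?_ ?_ <;>
    (unfold dot; fun_prop)

/-- Pairs of placements such that the triangles of the second one are moved copies of those of the
first one, one of them fixed, but some vertex has moved by `ε`. -/
def displacedPairs (n : ℕ) (ε : ℝ) : Set (Placement n × Placement n) :=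
  {v | (∀ i j : Fin n, (j : ℕ) = i + 1 → v.2 i 1 = v.2 j 0) ∧
    (∀ i j, i ≠ j → Separated (v.2 i) (v.2 j)) ∧
    (∀ i, ‖v.2 i 1 - v.2 i 0‖ = ‖v.1 i 1 - v.1 i 0‖ ∧
      (v.2 i 2 - v.2 i 0) * (v.1 i 1 - v.1 i 0) = (v.1 i 2 - v.1 i 0) * (v.2 i 1 - v.2 i 0)) ∧
    (∃ i, v.2 i = v.1 i) ∧ dist v.2 v.1 = ε}

/-- Every clause is closed by design: weak separation replaces disjointness from interiors,
polynomial identities replace rigid motions, and nondegeneracy, an open condition, is left out. -/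
theorem isClosed_displacedPairs (n : ℕ) (ε : ℝ) : IsClosed (displacedPairs n ε) := by
  unfold displacedPairs
  simp only [Set.ofPred_and, Set.ofPred_forall, Set.ofPred_exists]
  refine IsClosed.inter ?_ (IsClosed.inter ?_ (IsClosed.inter ?_ (IsClosed.inter ?_ ?_)))
  · exact isClosed_iInter fun i => isClosed_iInter fun j => isClosed_iInter fun _ =>
      isClosed_eq (by fun_prop) (by fun_prop)
  · refine isClosed_iInter fun i => isClosed_iInter fun j => isClosed_iInter fun _ => ?_
    exact isClosed_separated.preimage (f := fun v : Placement n × Placement n => (v.2 i, v.2 j))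
      (by fun_prop)
  · exact isClosed_iInter fun i => (isClosed_eq (by fun_prop) (by fun_prop)).inter
      (isClosed_eq (by fun_prop) (by fun_prop))
  · exact isClosed_iUnion_of_finite fun i => isClosed_eq (by fun_prop) (by fun_prop)
  · exact isClosed_eq (by fun_prop) (by fun_prop)

theorem tightSeven_ne {ℓ : ℝ} (hℓ : 0 < ℓ) (i : Fin 7) {j k : Fin 3} (hjk : j ≠ k) :
    tightSeven ℓ i j ≠ tightSeven ℓ i k := by
  rw [← sub_ne_zero, ← norm_pos_iff, norm_tightSeven_sub hℓ.le i hjk]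
  exact hℓ

theorem tightSeven_not_displaced {ℓ ε : ℝ} (hℓ : 0 < ℓ) (hε : 0 < ε) (hε' : ε ≤ ℓ / 1000)
    (x : Placement 7) : (tightSeven ℓ, x) ∉ displacedPairs 7 ε := by
  rintro ⟨hh, hs, hr, ⟨i, hi⟩, hd⟩
  simp only at hh hs hr hi hd
  obtain ⟨a, b, ha, h⟩ := rigidlyMoved_tightSeven_of_near hℓ hh hs
    (fun i => rigidlyMoved_of_triangle (tightSeven_ne hℓ i (by decide)) (hr i).1 (hr i).2)
    fun i k => by
      rw [← dist_eq_norm]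
      exact ((dist_le_pi_dist (x i) _ k).trans (dist_le_pi_dist x _ i)).trans (hd.le.trans hε')
  have hm : RigidlyMoved (fun v : Fin 7 × Fin 3 => tightSeven ℓ v.1 v.2)
      (fun v : Fin 7 × Fin 3 => x v.1 v.2) := ⟨a, b, ha, fun v => h v.1 v.2⟩
  have := hm.eq_of_two (j := (i, 0)) (k := (i, 1))
    (tightSeven_ne hℓ i (j := 0) (k := 1) (by decide))
    (congrFun hi 0) (congrFun hi 1)
  have hx : x = tightSeven ℓ := by
    funext i k
    exact congrFun this (i, k)
  rw [hx, dist_self] at hd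
  exact hε.ne hd

/-- The first components of a compact set of displaced pairs form a closed set that misses the tight
chain, hence a whole ball around it. -/
theorem exists_radius_not_displaced {ℓ ε : ℝ} (hℓ : 0 < ℓ) (hε : 0 < ε) (hε' : ε ≤ ℓ / 1000) :
    ∃ δ > 0, ∀ c x, dist c (tightSeven ℓ) ≤ δ → (c, x) ∉ displacedPairs 7 ε := by
  have hK : IsCompact (displacedPairs 7 ε ∩
      Metric.closedBall ((tightSeven ℓ, tightSeven ℓ) : Placement 7 × Placement 7) (1 + ε)) :=
    (isCompact_closedBall _ _).inter_left (isClosed_displacedPairs 7 ε)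
  have hF := (hK.image continuous_fst).isClosed
  have hmem : tightSeven ℓ ∈ (Prod.fst '' (displacedPairs 7 ε ∩ Metric.closedBall
      ((tightSeven ℓ, tightSeven ℓ) : Placement 7 × Placement 7) (1 + ε)))ᶜ := by
    rintro ⟨⟨c, x⟩, ⟨h, -⟩, rfl⟩
    exact tightSeven_not_displaced hℓ hε hε' x h
  obtain ⟨δ, hδ, hb⟩ := Metric.isOpen_iff.1 hF.isOpen_compl _ hmem
  refine ⟨min (δ / 2) 1, by positivity, fun c x hc h => ?_⟩
  have h1 : dist c (tightSeven ℓ) < δ := by linarith [hc.trans (min_le_left _ _)]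
  refine hb (Metric.mem_ball.2 h1) ⟨(c, x), ⟨h, ?_⟩, rfl⟩
  have hd : dist x c = ε := h.2.2.2.2
  have h2 := hc.trans (min_le_right _ _)
  rw [Metric.mem_closedBall, Prod.dist_eq, max_le_iff]
  exact ⟨by simp only; linarith, by simp only; linarith [dist_triangle x c (tightSeven ℓ)]⟩

theorem stronglyLocked_tightSeven {ℓ : ℝ} (hℓ : 0 < ℓ) : StronglyLocked (tightSeven ℓ) := by
  intro ε hε
  obtain ⟨ε', hε', h1, h2⟩ : ∃ ε' > 0, ε' ≤ ε ∧ ε' ≤ ℓ / 1000 :=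
    ⟨min ε (ℓ / 1000), by positivity, min_le_left _ _, min_le_right _ _⟩
  obtain ⟨δ, hδ, hno⟩ := exists_radius_not_displaced hℓ hε' h2
  refine ⟨δ, hδ, fun c hc γ hγ ⟨i₀, j, k, hjk, hpin⟩ t i w hw => ?_⟩
  have hle : dist (γ t) c ≤ ε' := by
    by_contra hlt
    push Not at hlt
    -- By the intermediate value theorem the displacement equals `ε'` at some time. The pinned bar
    -- then keeps its whole triangle fixed, since reflections are excluded, giving a displaced pair.
    obtain ⟨s, hs⟩ := mem_range_of_exists_le_of_exists_ge (c := ε')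
      (f := fun s => dist (γ s) c) (by have := hγ.continuous; fun_prop)
      ⟨0, by simpa [hγ.start] using hε'.le⟩ ⟨t, hlt.le⟩
    refine hno c (γ s) ?_ ⟨(hγ.mem s).1.hinged, fun i j hij => (hγ.mem s).1.separated hij,
      fun i => ((hγ.mem s).2 i).triangle, ⟨i₀, ?_⟩, hs⟩
    · exact (dist_pi_le_iff hδ.le).2 fun i => (dist_pi_le_iff hδ.le).2 fun k => hc.2 i k
    · have := hpin s
      rw [hγ.start] at this
      exact ((hγ.mem s).2 i₀).eq_of_two (hc.1.ne i₀ hjk) this.1 this.2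
  have hv : ∀ l, ‖γ t i l - c i l‖ ≤ ε := fun l => by
    rw [← dist_eq_norm]
    exact ((dist_le_pi_dist (γ t i) _ l).trans (dist_le_pi_dist (γ t) _ i)).trans (hle.trans h1)
  rw [dist_eq_norm, ← Finset.sum_sub_distrib]
  calc ‖∑ l, (w l • γ t i l - w l • c i l)‖ ≤ ∑ l, ‖w l • γ t i l - w l • c i l‖ := norm_sum_le _ _
    _ ≤ ∑ l, w l * ε := by
      refine Finset.sum_le_sum fun l _ => ?_
      rw [← smul_sub, norm_smul, Real.norm_eq_abs, abs_of_nonneg (hw.1 l)]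
      exact mul_le_mul_of_nonneg_left (hv l) (hw.1 l)
    _ = ε := by rw [← Finset.sum_mul, hw.2, one_mul]

/-! ### Rigidity -/

theorem LockedWithin.dist_le {n : ℕ} {ε : ℝ} {c : Placement n} (h : LockedWithin ε c)
    {γ : unitInterval → Placement n} (hγ : IsMotion c γ) {i₀ : Fin n} (hp : Pins γ i₀ 0 1)
    (t : unitInterval) (i : Fin n) (k : Fin 3) : dist (γ t i k) (c i k) ≤ ε := by
  have := h γ hγ ⟨i₀, 0, 1, by decide, hp⟩ t i (Pi.single k 1) (single_mem_stdSimplex ℝ k)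
  simpa [Pi.single_apply, ite_smul] using this

/-- A motion can be followed by rigid motions of the plane that keep a given triangle fixed. -/
theorem IsMotion.exists_pinned {n : ℕ} {c : Placement n} {γ : unitInterval → Placement n}
    (hγ : IsMotion c γ) (i₀ : Fin n) : ∃ γ' : unitInterval → Placement n,
      IsMotion c γ' ∧ Pins γ' i₀ 0 1 ∧ ∀ t, RigidlyMoved
        (fun v : Fin n × Fin 3 => γ' t v.1 v.2) (fun v : Fin n × Fin 3 => γ t v.1 v.2) := by
  have hc : IsConfiguration c := by rw [← hγ.start]; exact (hγ.mem 0).1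
  have hne : c i₀ 1 - c i₀ 0 ≠ 0 := sub_ne_zero.2 (hc.ne i₀ (by decide))
  have hneγ : ∀ t, γ t i₀ 1 - γ t i₀ 0 ≠ 0 := fun t =>
    sub_ne_zero.2 ((hγ.mem t).1.ne i₀ (by decide))
  have hcont := hγ.continuous
  obtain ⟨A, hA⟩ : ∃ A : unitInterval → ℂ,
    A = fun t => (c i₀ 1 - c i₀ 0) / (γ t i₀ 1 - γ t i₀ 0) := ⟨_, rfl⟩
  have hAt : ∀ t, A t * (γ t i₀ 1 - γ t i₀ 0) = c i₀ 1 - c i₀ 0 := fun t => by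
    rw [hA]; exact div_mul_cancel₀ _ (hneγ t)
  have hAn : ∀ t, ‖A t‖ = 1 := fun t => by
    rw [hA]
    simp only
    rw [norm_div, ((hγ.mem t).2 i₀).triangle.1, div_self (norm_ne_zero_iff.2 hne)]
  have hA0 : ∀ t, A t ≠ 0 := fun t => by rw [← norm_pos_iff, hAn]; exact one_pos
  have hAc : Continuous A := by
    rw [hA]
    exact Continuous.div (by fun_prop) (by fun_prop) hneγ
  refine ⟨fun t i k => A t * γ t i k + (c i₀ 0 - A t * γ t i₀ 0), ⟨by fun_prop, ?_, fun t => ?_⟩,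
    fun t => ?_, fun t => ?_⟩
  · have h1 : A 0 = 1 := by
      rw [hA]; simp only; rw [hγ.start]; exact div_self hne
    funext i k
    rw [h1, hγ.start]; ring
  · refine ⟨(hγ.mem t).1.affine (hA0 t) _, fun i => ((hγ.mem t).2 i).comp ?_⟩
    exact ⟨A t, _, hAn t, fun k => rfl⟩
  · simp only
    constructor
    · ring
    · linear_combination hAt t - hAt 0
  · refine ⟨(A t)⁻¹, γ t i₀ 0 - (A t)⁻¹ * c i₀ 0, by rw [norm_inv, hAn, inv_one], fun v => ?_⟩
    have := hA0 t
    simp only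
    field_simp
    ring

theorem rigid_tightSeven {ℓ : ℝ} (hℓ : 0 < ℓ) (hc : IsConfiguration (tightSeven ℓ)) :
    Rigid (tightSeven ℓ) := by
  intro γ hγ t
  obtain ⟨γ', hγ', hp, hr⟩ := hγ.exists_pinned 0
  have : γ' t = tightSeven ℓ := by
    funext i k
    refine eq_of_forall_dist_le fun ε hε => ?_
    obtain ⟨δ, hδ, h⟩ := stronglyLocked_tightSeven hℓ ε hε
    exact (h _ ⟨hc, fun i k => by rw [dist_self]; exact hδ.le⟩).dist_le hγ' hp t i k
  have h := hr t
  rwa [this] at h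

/-! ### Non-self-touching perturbations -/

/-- If every two triangles of a chain are separated by a line which the later of them touches at most
in the hinge, then the chain is a configuration without self-touching. -/
theorem isNonSelfTouching_of_lines {n : ℕ} {c : Placement n}
    (h₁ : ∀ i, AffineIndependent ℝ (c i)) (h₂ : ∀ i j : Fin n, (j : ℕ) = i + 1 → c i 1 = c j 0)
    (h₃ : ∀ i j : Fin n, i < j → ∃ (v : ℂ) (u : ℝ), (∀ k, dot v (c i k) ≤ u) ∧
      (∀ l, u ≤ dot v (c j l)) ∧ ∀ l, ((j : ℕ) = i + 1 → l ≠ 0) → u < dot v (c j l)) :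
    IsNonSelfTouching c := by
  refine ⟨isConfiguration_of_separated h₁ h₂ fun i j hij => ?_, fun i j hij => ?_,
    fun i j hij => ?_⟩
  · obtain ⟨v, u, hi, hj, hs⟩ := h₃ i j hij
    refine separated_of_ne_zero (n := v) ?_ fun k l => (hi k).trans (hj l)
    rintro rfl
    have h1 := hi 0
    have h2 := hs 1 (fun _ => by decide)
    simp [dot] at h1 h2
    linarith
  · have hlt : i < j := by rw [Fin.lt_def]; omega
    obtain ⟨v, u, hi, hj, hs⟩ := h₃ i j hlt
    ext z
    rw [Set.mem_singleton_iff]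
    constructor
    · rintro ⟨hz, hz'⟩
      have hzu : dot v z ≤ u := dot_le_of_mem_convexHull hi hz
      -- An open half-plane with one boundary point added is still convex, so the later triangle
      -- meets the line only in the hinge.
      have hsub : Set.range (c j) ⊆ {y | u ≤ dot v y ∧ (dot v y = u → y = c j 0)} := by
        rintro _ ⟨l, rfl⟩
        refine ⟨hj l, fun h => ?_⟩
        by_cases hl : l = 0
        · rw [hl]
        · exact absurd h (hs l fun _ => hl).ne'
      have hconv : Convex ℝ {y | u ≤ dot v y ∧ (dot v y = u → y = c j 0)} := by
        rintro x ⟨hx, hx'⟩ y ⟨hy, hy'⟩ a b ha hb hab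
        simp only [Set.mem_ofPred_eq, dot_add, dot_smul]
        have key : a * dot v x + b * dot v y = u + a * (dot v x - u) + b * (dot v y - u) := by
          linear_combination u * hab
        have px := mul_nonneg ha (sub_nonneg.2 hx)
        have py := mul_nonneg hb (sub_nonneg.2 hy)
        refine ⟨by linarith, fun h => ?_⟩
        have hxa : a * (dot v x - u) = 0 := by linarith
        have hyb : b * (dot v y - u) = 0 := by linarith
        rcases mul_eq_zero.1 hxa with h1 | h1
        · have hb1 : b = 1 := by linarith
          rw [h1, zero_smul, zero_add, hb1, one_smul]
          exact hy' (by rw [hb1] at hyb; linarith)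
        · rcases mul_eq_zero.1 hyb with h2 | h2
          · have ha1 : a = 1 := by linarith
            rw [h2, zero_smul, add_zero, ha1, one_smul]
            exact hx' (by linarith)
          · rw [hx' (by linarith), hy' (by linarith), ← add_smul, hab, one_smul]
      obtain ⟨h1, h2⟩ := convexHull_min hsub hconv hz'
      rw [h₂ i j hij]
      exact h2 (le_antisymm hzu h1)
    · rintro rfl
      refine ⟨subset_convexHull ℝ _ ⟨1, rfl⟩, ?_⟩
      rw [h₂ i j hij]
      exact subset_convexHull ℝ _ ⟨0, rfl⟩
  · have hlt : i < j := by rw [Fin.lt_def]; omega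
    obtain ⟨v, u, hi, hj, hs⟩ := h₃ i j hlt
    have hne : ∀ l, ((j : ℕ) = i + 1 → l ≠ (0 : Fin 3)) := fun l h => by omega
    rw [Set.disjoint_left]
    intro z hz hz'
    obtain ⟨l, hl⟩ : ∃ l, ∀ l', dot v (c j l) ≤ dot v (c j l') := Finite.exists_min _
    exact absurd ((le_dot_of_mem_convexHull hl hz').trans (dot_le_of_mem_convexHull hi hz))
      (not_le.2 (hs l (hne l)))

/-- First coordinates (in units of `√3 / 2 * ℓ` and `ℓ`) of the vertices of the chain of
seven triangles, after some of them have been moved into the interior of their triangles. -/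
def loosenedX (t : ℝ) : Fin 7 → Fin 3 → ℝ :=
  ![![-t, 0, -1 + 2 * t], ![0, 0, -1], ![0, 1, t], ![1, 1, 2 * t], ![1, 0, t], ![0, -1, -1],
    ![-1, -2 * t, -1 + t]]

/-- The second coordinates of the vertices described at `loosenedX`. -/
def loosenedY (t : ℝ) : Fin 7 → Fin 3 → ℝ :=
  ![![-1 + 3 / 2 * t, 0, -1 / 2], ![0, 1, 1 / 2], ![1, 1 / 2, 3 / 2 * t], ![1 / 2, -1 / 2, 0],
    ![-1 / 2, -1, -3 / 2 * t], ![-1, -1 / 2, -3 / 2], ![-1 / 2, 0, 1 / 2 - 3 / 2 * t]]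

/-- The loosened chain of seven triangles, which is the tight one for `t = 0`. -/
def loosened (ℓ t : ℝ) : Placement 7 :=
  fun i k => ⟨√3 / 2 * ℓ * loosenedX t i k, ℓ * loosenedY t i k⟩

/-- Lines `α X + β Y = γ` separating the triangles of the loosened chain. -/
def sepLine (t : ℝ) : Fin 7 → Fin 7 → ℝ × ℝ × ℝ :=
  ![![(0, 0, 0), (0, 1, 0), (0, 1, 0), (1, 0, 0), (1, -t, 0), (-1 / 2, -1, 1 - t), (-1 / 2 - t, 1, 0)],
    ![(0, 0, 0), (0, 0, 0), (1, 0, 0), (1, 0, 0), (1, -1, 0), (0, -1, 0), (-1 / 2, -1, 0)],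
    ![(0, 0, 0), (0, 0, 0), (0, 0, 0), (1 / 2, -1, 0), (0, -1, 0), (0, -1, 0), (-1, 0, 0)],
    ![(0, 0, 0), (0, 0, 0), (0, 0, 0), (0, 0, 0), (-1 / 2, -1, 0), (-1 / 2, -1, 0), (-1, 0, 0)],
    ![(0, 0, 0), (0, 0, 0), (0, 0, 0), (0, 0, 0), (0, 0, 0), (-1, 0, 0), (-1, 0, 0)],
    ![(0, 0, 0), (0, 0, 0), (0, 0, 0), (0, 0, 0), (0, 0, 0), (0, 0, 0), (0, 1, -1 / 2)],
    fun _ => (0, 0, 0)]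

theorem sepLine_ne_zero (t : ℝ) {i j : Fin 7} (hij : i < j) :
    (sepLine t i j).1 ≠ 0 ∨ (sepLine t i j).2.1 ≠ 0 := by
  fin_cases i <;> fin_cases j <;> first | (exact absurd hij (by decide)) | simp [sepLine]

theorem loosened_le_sepLine {t : ℝ} (ht : 0 ≤ t) (ht' : t ≤ 1 / 10) {i j : Fin 7} (hij : i < j)
    (k : Fin 3) : (sepLine t i j).1 * loosenedX t i k + (sepLine t i j).2.1 * loosenedY t i k ≤
      (sepLine t i j).2.2 := by
  revert k
  fin_cases i <;> fin_cases j <;> first | (exact absurd hij (by decide)) | skip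
  all_goals simp [sepLine, loosenedX, loosenedY, Fin.forall_fin_succ]
  all_goals (try refine ⟨?_, ?_⟩) <;> (try refine ⟨?_, ?_⟩) <;> nlinarith

theorem sepLine_le_loosened {t : ℝ} (ht : 0 ≤ t) (ht' : t ≤ 1 / 10) {i j : Fin 7} (hij : i < j)
    (k : Fin 3) : (sepLine t i j).2.2 ≤
      (sepLine t i j).1 * loosenedX t j k + (sepLine t i j).2.1 * loosenedY t j k := by
  revert k
  fin_cases i <;> fin_cases j <;> first | (exact absurd hij (by decide)) | skip
  all_goals simp [sepLine, loosenedX, loosenedY, Fin.forall_fin_succ]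
  all_goals (try refine ⟨?_, ?_⟩) <;> (try refine ⟨?_, ?_⟩) <;> nlinarith

theorem sepLine_lt_loosened {t : ℝ} (ht : 0 < t) (ht' : t ≤ 1 / 10) {i j : Fin 7} (hij : i < j)
    (k : Fin 3) (hk : (j : ℕ) = i + 1 → k ≠ 0) : (sepLine t i j).2.2 <
      (sepLine t i j).1 * loosenedX t j k + (sepLine t i j).2.1 * loosenedY t j k := by
  revert k
  fin_cases i <;> fin_cases j <;> first | (exact absurd hij (by decide)) | skip
  all_goals simp [sepLine, loosenedX, loosenedY, Fin.forall_fin_succ]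
  all_goals (try refine ⟨?_, ?_⟩) <;> (try refine ⟨?_, ?_⟩) <;> nlinarith

theorem affineIndependent_loosened {ℓ t : ℝ} (hℓ : 0 < ℓ) (ht : 0 ≤ t) (ht' : t ≤ 1 / 10)
    (i : Fin 7) : AffineIndependent ℝ (loosened ℓ t i) := by
  rw [affineIndependent_iff_cross]
  have h : 0 < (loosenedX t i 1 - loosenedX t i 0) * (loosenedY t i 2 - loosenedY t i 0) -
        (loosenedY t i 1 - loosenedY t i 0) * (loosenedX t i 2 - loosenedX t i 0) ∨
      (loosenedX t i 1 - loosenedX t i 0) * (loosenedY t i 2 - loosenedY t i 0) -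
        (loosenedY t i 1 - loosenedY t i 0) * (loosenedX t i 2 - loosenedX t i 0) < 0 := by
    fin_cases i <;> first
      | (left; simp [loosenedX, loosenedY]; done)
      | (left; simp [loosenedX, loosenedY]; nlinarith)
      | (right; simp [loosenedX, loosenedY]; done)
      | (right; simp [loosenedX, loosenedY]; nlinarith)
  have h2 : √3 / 2 * ℓ * ℓ ≠ 0 := by positivity
  convert mul_ne_zero h2 (ne_iff_lt_or_gt.2 h.symm) using 1
  simp only [loosened, Complex.sub_re, Complex.sub_im]
  ring

theorem loosened_hinged (ℓ t : ℝ) (i j : Fin 7) (hij : (j : ℕ) = i + 1) :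
    loosened ℓ t i 1 = loosened ℓ t j 0 := by
  fin_cases i <;> fin_cases j <;>
    first | (exact absurd hij (by decide)) | simp [loosened, loosenedX, loosenedY]

theorem dot_loosened (ℓ t α β : ℝ) (i : Fin 7) (k : Fin 3) :
    dot ⟨2 / √3 * α, β⟩ (loosened ℓ t i k) = ℓ * (α * loosenedX t i k + β * loosenedY t i k) := by
  have h : √3 ≠ 0 := by positivity
  simp only [dot, loosened]
  field_simp

theorem tightSeven_eq_loosened (ℓ : ℝ) : tightSeven ℓ = loosened ℓ 0 := by
  funext i k
  rw [tightSeven_apply]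
  fin_cases i <;> fin_cases k <;>
    simp [loosened, loosenedX, loosenedY, Complex.ext_iff] <;> ring

theorem isConfiguration_tightSeven {ℓ : ℝ} (hℓ : 0 < ℓ) : IsConfiguration (tightSeven ℓ) := by
  rw [tightSeven_eq_loosened]
  refine isConfiguration_of_separated
    (affineIndependent_loosened hℓ le_rfl (by norm_num)) (loosened_hinged ℓ 0) fun i j hij => ?_
  refine separated_of_ne_zero (n := ⟨2 / √3 * (sepLine 0 i j).1, (sepLine 0 i j).2.1⟩) ?_
    fun k l => ?_
  · intro h
    have h3 : 2 / √3 ≠ 0 := by positivity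
    have h1 := congrArg Complex.re h
    have h2 := congrArg Complex.im h
    simp only [Complex.zero_re, Complex.zero_im] at h1 h2
    rcases sepLine_ne_zero 0 hij with h' | h'
    · exact h' ((mul_eq_zero.1 h1).resolve_left h3)
    · exact h' h2
  · rw [dot_loosened, dot_loosened]
    exact mul_le_mul_of_nonneg_left ((loosened_le_sepLine le_rfl (by norm_num) hij k).trans
      (sepLine_le_loosened le_rfl (by norm_num) hij l)) hℓ.le

theorem isNonSelfTouching_loosened {ℓ t : ℝ} (hℓ : 0 < ℓ) (ht : 0 < t) (ht' : t ≤ 1 / 10) :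
    IsNonSelfTouching (loosened ℓ t) := by
  refine isNonSelfTouching_of_lines (affineIndependent_loosened hℓ ht.le ht')
    (loosened_hinged ℓ t) fun i j hij => ?_
  refine ⟨⟨2 / √3 * (sepLine t i j).1, (sepLine t i j).2.1⟩, ℓ * (sepLine t i j).2.2,
    fun k => ?_, fun l => ?_, fun l hl => ?_⟩ <;> rw [dot_loosened]
  · exact mul_le_mul_of_nonneg_left (loosened_le_sepLine ht.le ht' hij k) hℓ.le
  · exact mul_le_mul_of_nonneg_left (sepLine_le_loosened ht.le ht' hij l) hℓ.le
  · exact mul_lt_mul_of_pos_left (sepLine_lt_loosened ht ht' hij l hl) hℓ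

theorem dist_loosened_le {ℓ t : ℝ} (hℓ : 0 < ℓ) (ht : 0 ≤ t) (i : Fin 7) (k : Fin 3) :
    dist (loosened ℓ t i k) (tightSeven ℓ i k) ≤ 4 * ℓ * t := by
  have hX : |loosenedX t i k - loosenedX 0 i k| ≤ 2 * t := by
    rw [abs_le]
    fin_cases i <;> fin_cases k <;> simp [loosenedX] <;> (try constructor) <;> linarith
  have hY : |loosenedY t i k - loosenedY 0 i k| ≤ 2 * t := by
    rw [abs_le]
    fin_cases i <;> fin_cases k <;> simp [loosenedY] <;> (try constructor) <;> linarith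
  have h3 : √3 / 2 ≤ 1 := by
    have : √3 ≤ 2 := Real.sqrt_le_iff.2 (by norm_num)
    linarith
  rw [tightSeven_eq_loosened, dist_eq_norm]
  refine (Complex.norm_le_abs_re_add_abs_im _).trans ?_
  simp only [loosened, Complex.sub_re, Complex.sub_im]
  rw [← mul_sub, ← mul_sub, abs_mul, abs_mul, abs_mul, abs_of_pos hℓ,
    abs_of_nonneg (by positivity : 0 ≤ √3 / 2)]
  have h4 : √3 / 2 * ℓ * |loosenedX t i k - loosenedX 0 i k| ≤ 1 * ℓ * (2 * t) := by gcongr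
  have h5 : ℓ * |loosenedY t i k - loosenedY 0 i k| ≤ ℓ * (2 * t) := by gcongr
  linarith

theorem exists_nonSelfTouching_perturbation {ℓ : ℝ} (hℓ : 0 < ℓ) {δ : ℝ} (hδ : 0 < δ) :
    ∃ c, IsPerturbation δ (tightSeven ℓ) c ∧ IsNonSelfTouching c := by
  obtain ⟨t, ht, h1, h2⟩ : ∃ t > 0, t ≤ 1 / 10 ∧ t ≤ δ / (4 * ℓ) :=
    ⟨min (1 / 10) (δ / (4 * ℓ)), by positivity, min_le_left _ _, min_le_right _ _⟩
  have h := isNonSelfTouching_loosened hℓ ht h1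
  refine ⟨loosened ℓ t, ⟨h.toIsConfiguration, fun i k => ?_⟩, h⟩
  refine (dist_loosened_le hℓ ht.le i k).trans ?_
  rw [le_div_iff₀ (by positivity)] at h2
  linarith

/-! ### The spread-out chain and lockedness -/

/-- The position on the real axis of the first hinge of triangle `m` in the spread-out chain. -/
def spreadOffset {n : ℕ} (c : Placement n) (m : ℕ) : ℝ :=
  ∑ j ∈ Finset.range m, if h : j < n then ‖c ⟨j, h⟩ 1 - c ⟨j, h⟩ 0‖ else 0

/-- The placement of the chain with all bases in a row on the real axis. -/
def spread {n : ℕ} (c : Placement n) : Placement n := fun i k =>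
  starRingEnd ℂ (c i 1 - c i 0) / ‖c i 1 - c i 0‖ * (c i k - c i 0) + spreadOffset c i

theorem spreadOffset_succ {n : ℕ} (c : Placement n) (i : Fin n) :
    spreadOffset c (i + 1) = spreadOffset c i + ‖c i 1 - c i 0‖ := by
  rw [spreadOffset, Finset.sum_range_succ, dif_pos i.2, spreadOffset]

theorem spreadOffset_mono {n : ℕ} (c : Placement n) : Monotone (spreadOffset c) :=
  monotone_nat_of_le_succ fun m => by
    rw [spreadOffset, spreadOffset, Finset.sum_range_succ]
    split_ifs <;> simp

theorem spread_zero {n : ℕ} (c : Placement n) (i : Fin n) : spread c i 0 = spreadOffset c i := by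
  simp [spread]

theorem spread_one {n : ℕ} {c : Placement n} {i : Fin n} (h : c i 0 ≠ c i 1) :
    spread c i 1 = spreadOffset c (i + 1) := by
  have hne : (‖c i 1 - c i 0‖ : ℂ) ≠ 0 := by
    exact_mod_cast norm_ne_zero_iff.2 (sub_ne_zero.2 h.symm)
  rw [spread, spreadOffset_succ, Complex.ofReal_add, add_comm, div_mul_eq_mul_div, mul_comm,
    Complex.mul_conj', sq, mul_div_cancel_right₀ _ hne]

theorem spread_two_re {n : ℕ} (c : Placement n) (i : Fin n) : (spread c i 2).re =
    spreadOffset c i + dot (c i 1 - c i 0) (c i 2 - c i 0) / ‖c i 1 - c i 0‖ := by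
  rw [spread, div_mul_eq_mul_div, Complex.add_re, Complex.div_ofReal_re, Complex.ofReal_re, add_comm]
  congr 2
  simp [dot]
  ring

theorem rigidlyMoved_spread {n : ℕ} {c : Placement n} {i : Fin n} (h : c i 0 ≠ c i 1) :
    RigidlyMoved (c i) (spread c i) := by
  have hne := norm_ne_zero_iff.2 (sub_ne_zero.2 h.symm)
  refine ⟨starRingEnd ℂ (c i 1 - c i 0) / ‖c i 1 - c i 0‖,
    spreadOffset c i - starRingEnd ℂ (c i 1 - c i 0) / ‖c i 1 - c i 0‖ * c i 0, ?_, fun k => ?_⟩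
  · rw [norm_div, Complex.norm_conj, Complex.norm_real, norm_norm, div_self hne]
  · rw [spread]; ring

theorem RigidlyMoved.affineIndependent {p q : Fin 3 → ℂ} (h : RigidlyMoved p q)
    (hp : AffineIndependent ℝ p) : AffineIndependent ℝ q := by
  obtain ⟨a, b, ha, h⟩ := h
  rw [affineIndependent_iff_cross] at hp ⊢
  have h2 := sq_of_norm_eq ha
  convert hp using 1
  simp only [h, Complex.sub_re, Complex.sub_im, Complex.add_re, Complex.add_im, Complex.mul_re,
    Complex.mul_im]
  linear_combination (((p 1).re - (p 0).re) * ((p 2).im - (p 0).im) -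
    ((p 1).im - (p 0).im) * ((p 2).re - (p 0).re)) * h2

/-- The hypotheses say that the base angles are acute, so each apex projects into the interior of
its base. Vertical lines through the hinges then separate the triangles. -/
theorem isNonSelfTouching_spread {n : ℕ} {c : Placement n} (hc : IsConfiguration c)
    (h₁ : ∀ i, 0 < dot (c i 1 - c i 0) (c i 2 - c i 0))
    (h₂ : ∀ i, dot (c i 1 - c i 0) (c i 2 - c i 0) < ‖c i 1 - c i 0‖ ^ 2) :
    IsNonSelfTouching (spread c) := by
  have hne : ∀ i, c i 0 ≠ c i 1 := fun i => hc.ne i (by decide)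
  have hpos : ∀ i, 0 < ‖c i 1 - c i 0‖ := fun i => norm_pos_iff.2 (sub_ne_zero.2 (hne i).symm)
  have hre : ∀ z : ℂ, dot 1 z = z.re := fun z => by simp [dot]
  have h2 : ∀ i : Fin n, (spread c i 2).re ≤ spreadOffset c (i + 1) := fun i => by
    rw [spread_two_re, spreadOffset_succ, add_le_add_iff_left, div_le_iff₀ (hpos i), ← sq]
    exact (h₂ i).le
  have h2' : ∀ i : Fin n, spreadOffset c i < (spread c i 2).re := fun i => by
    rw [spread_two_re]
    exact lt_add_of_pos_right _ (div_pos (h₁ i) (hpos i))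
  have hlt : ∀ i : Fin n, spreadOffset c i < spreadOffset c (i + 1) := fun i => by
    rw [spreadOffset_succ]; exact lt_add_of_pos_right _ (hpos i)
  refine isNonSelfTouching_of_lines (fun i => (rigidlyMoved_spread (hne i)).affineIndependent
    (hc.nondegenerate i)) (fun i j hij => ?_) fun i j hij => ?_
  · rw [spread_one (hne i), spread_zero, hij]
  · have hij' : spreadOffset c (i + 1) ≤ spreadOffset c j := spreadOffset_mono c hij
    refine ⟨1, spreadOffset c (i + 1), fun k => ?_, fun l => ?_, fun l hl => ?_⟩ <;> rw [hre]
    · fin_cases k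
      · simpa [spread_zero] using (hlt i).le
      · simp [spread_one (hne i)]
      · exact h2 i
    · refine hij'.trans ?_
      fin_cases l
      · simp [spread_zero]
      · simpa [spread_one (hne j)] using (hlt j).le
      · exact (h2' j).le
    · have h0 : l ≠ 0 → spreadOffset c j < (spread c j l).re := by
        fin_cases l
        · simp
        · simpa [spread_one (hne j)] using hlt j
        · exact fun _ => h2' j
      by_cases hl0 : l = 0
      · have hij2 : (i : ℕ) + 1 < j := lt_of_le_of_ne hij fun e => hl e.symm hl0
        have := (hlt ⟨i + 1, hij2.trans j.2⟩).trans_le (spreadOffset_mono c hij2)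
        rw [hl0, spread_zero]
        exact this
      · exact hij'.trans_lt (h0 hl0)

theorem RigidlyMoved.dist_eq {ι : Type*} {p q : ι → ℂ} (h : RigidlyMoved p q) (j k : ι) :
    dist (q j) (q k) = dist (p j) (p k) := by
  obtain ⟨a, b, ha, h⟩ := h
  rw [h, h, dist_eq_norm, dist_eq_norm, show a * p j + b - (a * p k + b) = a * (p j - p k) by ring,
    norm_mul, ha, one_mul]

theorem two_mul_dot_eq (d e : ℂ) : 2 * dot d e = ‖d‖ ^ 2 + ‖e‖ ^ 2 - ‖e - d‖ ^ 2 := by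
  rw [← dot_self, ← dot_self, ← dot_self]
  simp [dot]
  ring

/-- Perturbations of the seven-triangle chain that are locked within a small distance are locked:
the spread-out configuration cannot be reached. -/
theorem locked_of_lockedWithin {ℓ : ℝ} (hℓ : 0 < ℓ) {c : Placement 7}
    (hc : IsPerturbation (ℓ / 100) (tightSeven ℓ) c) (hl : LockedWithin ℓ c) : Locked c := by
  have hside : ∀ i j k, j ≠ k → |‖c i j - c i k‖ - ℓ| ≤ ℓ / 50 := fun i j k hjk => by
    rw [← norm_tightSeven_sub hℓ.le i hjk]
    refine (abs_norm_sub_norm_le _ _).trans ?_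
    rw [show c i j - c i k - (tightSeven ℓ i j - tightSeven ℓ i k) =
      (c i j - tightSeven ℓ i j) - (c i k - tightSeven ℓ i k) by ring]
    refine (norm_sub_le _ _).trans ?_
    have h1 := hc.2 i j
    have h2 := hc.2 i k
    rw [dist_eq_norm] at h1 h2
    rw [norm_tightSeven_sub hℓ.le i hjk]
    linarith
  simp only [abs_le] at hside
  have hne : ∀ i, c i 0 ≠ c i 1 := fun i => hc.1.ne i (by decide)
  have hsp : IsNonSelfTouching (spread c) := by
    refine isNonSelfTouching_spread hc.1 (fun i => ?_) fun i => ?_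
    all_goals
      have hd := two_mul_dot_eq (c i 1 - c i 0) (c i 2 - c i 0)
      rw [sub_sub_sub_cancel_right] at hd
      have a := hside i 1 0 (by decide)
      have b := hside i 2 0 (by decide)
      have e := hside i 2 1 (by decide)
      nlinarith
  refine ⟨spread c, ⟨hsp.toIsConfiguration, fun i => rigidlyMoved_spread (hne i)⟩, hsp,
    fun ⟨γ, hγ⟩ => ?_⟩
  obtain ⟨γ', hγ', hp, hr⟩ := (IsMotion.mk γ.continuous γ.source hγ).exists_pinned 0
  -- The vertices p of the last triangle and m of the first start about `ℓ` apart. Each moves by at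
  -- most `ℓ`, so they end within about 3`ℓ`; in the spread-out chain five bases, of total length
  -- more than 4`ℓ`, lie between them.
  have h1 := hl.dist_le hγ' hp 1 6 0
  have h2 := hl.dist_le hγ' hp 1 0 1
  have h3 := (hr 1).dist_eq (6, 0) (0, 1)
  simp only [γ.target] at h3
  have h4 : dist (c 6 0) (c 0 1) ≤ ℓ + ℓ / 50 := by
    have e : tightSeven ℓ 0 1 = tightSeven ℓ 6 1 := by simp [tightSeven_apply]
    have h5 := hc.2 0 1
    have h6 := hc.2 6 0
    have h7 := norm_tightSeven_sub hℓ.le 6 (j := 0) (k := 1) (by decide)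
    rw [← dist_eq_norm, ← e] at h7
    rw [dist_comm] at h5
    linarith [dist_triangle (c 6 0) (tightSeven ℓ 6 0) (tightSeven ℓ 0 1),
      dist_triangle (c 6 0) (tightSeven ℓ 0 1) (c 0 1)]
  have h8 : 4 * ℓ ≤ dist (spread c 6 0) (spread c 0 1) := by
    rw [spread_zero, spread_one (hne 0), dist_eq_norm]
    refine le_trans ?_ (Complex.re_le_norm _)
    have s1 := spreadOffset_succ c 1
    have s2 := spreadOffset_succ c 2
    have s3 := spreadOffset_succ c 3
    have s4 := spreadOffset_succ c 4
    have s5 := spreadOffset_succ c 5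
    have t1 := (hside 1 1 0 (by decide)).1
    have t2 := (hside 2 1 0 (by decide)).1
    have t3 := (hside 3 1 0 (by decide)).1
    have t4 := (hside 4 1 0 (by decide)).1
    have t5 := (hside 5 1 0 (by decide)).1
    simp at s1 s2 s3 s4 s5 ⊢
    linarith
  rw [dist_comm] at h2
  linarith [dist_triangle (γ' 1 6 0) (c 6 0) (γ' 1 0 1),
    dist_triangle (c 6 0) (c 0 1) (γ' 1 0 1)]

end TriangleChain

end

theorem mainTheorem7 (ℓ : ℝ) (hℓ : 0 < ℓ) :
    TriangleChain.IsConfiguration (TriangleChain.tightSeven ℓ) ∧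
    TriangleChain.Rigid (TriangleChain.tightSeven ℓ) ∧
    TriangleChain.StronglyLocked (TriangleChain.tightSeven ℓ) ∧
    (∀ δ : ℝ, 0 < δ → ∃ c : TriangleChain.Placement 7,
      TriangleChain.IsPerturbation δ (TriangleChain.tightSeven ℓ) c ∧
      TriangleChain.IsNonSelfTouching c) ∧
    ∃ δ : ℝ, 0 < δ ∧ ∀ c : TriangleChain.Placement 7,
      TriangleChain.IsPerturbation δ (TriangleChain.tightSeven ℓ) c →
      TriangleChain.IsNonSelfTouching c → TriangleChain.Locked c := by
  refine ⟨TriangleChain.isConfiguration_tightSeven hℓ,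
    TriangleChain.rigid_tightSeven hℓ (TriangleChain.isConfiguration_tightSeven hℓ),
    TriangleChain.stronglyLocked_tightSeven hℓ,
    fun δ hδ => TriangleChain.exists_nonSelfTouching_perturbation hℓ hδ, ?_⟩
  -- Locking within one side length `ℓ` already excludes the spread-out configuration; `ℓ / 100`
  -- keeps the triangles acute.
  obtain ⟨δ, hδ, h⟩ := TriangleChain.stronglyLocked_tightSeven hℓ ℓ hℓ
  exact ⟨min δ (ℓ / 100), by positivity, fun c hc _ => TriangleChain.locked_of_lockedWithin hℓ
    ⟨hc.1, fun i k => (hc.2 i k).trans (min_le_right _ _)⟩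
    (h c ⟨hc.1, fun i k => (hc.2 i k).trans (min_le_left _ _)⟩)⟩
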